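/- Let $\mathbb{H}$ be the upper half plane, $q=e^{2\pi i z}$, and for $z\in\mathbb{H}$ let $$G_2(z)=-\frac1{24}+\sum_{n\ge1}\sigma_1(n)q^n,\qquad \theta(z)=\sum_{n\in\mathbb{Z}}q^{n^2},$$ where $\sigma_1(n)=\sum_{d\mid n}d$. For $m\in\{1,2,4\}$ put $$f_m(z)=G_2(mz)\,\theta(z)+\frac{1}{2\pi i\,m}\,\theta'(z).$$ Let $\mathbf{M}_{5/2}(\Gamma_0(4))$ be the space of functions $f:\mathbb{H}\to\mathbb{C}$ that are holomorphic on $\mathbb{H}$, are holomorphic at all cusps (that is, for every $\begin{pmatrix}a&b\\c&d\end{pmatrix}\in\mathrm{SL}(2,\mathbb{Z})$ the function $(cz+d)^{-5/2}f\!\left(\frac{az+b}{cz+d}\right)$ is bounded as $\operatorname{Im} z\to\infty$), and satisfy $$f\!\left(\frac{az+b}{cz+d}\right)=\left(\frac{c}{d}\right)\left(\frac{-4}{d}\right)^{-5/2}(cz+d)^{5/2}f(z)$$ for all $z\in\mathbb{H}$ and all $\begin{pmatrix}a&b\\c&d\end{pmatrix}\in\Gamma_0(4)$. Here $\left(\frac{\cdot}{\cdot}\right)$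 is the Kronecker symbol (with $\left(\frac{a}{-1}\right)=-1$ if $a<0$ and $1$ if $a\ge0$) and powers are taken with the principal branch. **Proposition.** The functions $f_1,f_2,f_4$ all belong to $\mathbf{M}_{5/2}(\Gamma_0(4))$, and $$f_1-5f_2+4f_4=0.$$ Consequently, if $f_m(z)=\sum_{n\ge0}a_m(n)q^n$ is the Fourier expansion of $f_m$ for $m=1,2,4$ (these expansions exist and converge on $\mathbb{H}$), then $a_1(n)-5a_2(n)+4a_4(n)=0$ for all integers $n\ge0$. -/

import Mathlib

open UpperHalfPlane CongruenceSubgroup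
open scoped MatrixGroups Manifold

noncomputable section

namespace HalfIntegralWeight

/-- The Kronecker symbol `(a / b)` of two integers. Its factors at `b` are: the sign of `b`
(contributing `-1` exactly when `a < 0` and `b < 0`), the powers of `2` (with `(a / 2) = χ₈(a)`,
that is `0` for even `a`, and `(-1) ^ ((a ^ 2 - 1) / 8)` for odd `a`), and the odd part of `|b|`
(Jacobi symbol). For `b = 0` it has the usual value `1` if `a = ±1` and `0` otherwise. -/
def kroneckerSym (a b : ℤ) : ℤ :=
  if b = 0 then (if a.natAbs = 1 then 1 else 0)
  else (if a < 0 ∧ b < 0 then -1 else 1)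
    * ZMod.χ₈ (a : ZMod 8) ^ padicValNat 2 b.natAbs
    * jacobiSym a (b.natAbs / 2 ^ padicValNat 2 b.natAbs)

/-- The factor by which a modular form of weight `κ / 2` (`κ` odd) on `Γ₀(N)`, `4 ∣ N`, is
multiplied under `γ = (a, b; c, d)`:
`(c / d) * (-4 / d) ^ (-κ / 2) * (c z + d) ^ (κ / 2)`, with principal branches. -/
def autFactor (κ : ℤ) (γ : SL(2, ℤ)) (z : ℍ) : ℂ :=
  (kroneckerSym (γ 1 0) (γ 1 1) : ℂ)
    * (kroneckerSym (-4) (γ 1 1) : ℂ) ^ (-(κ : ℂ) / 2)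
    * ((γ 1 0 : ℂ) * (z : ℂ) + (γ 1 1 : ℂ)) ^ ((κ : ℂ) / 2)

/-- The space `M_{κ/2}(Γ₀(N))` of (integral) modular forms of half-integral weight `κ / 2`, for
`κ` odd and `4 ∣ N`: holomorphic functions on the upper half plane, transforming under `Γ₀(N)` by
`autFactor κ`, and holomorphic at all cusps. As for Mathlib's modular forms of integral weight, the
last condition says that for every `γ = (a, b; c, d)` in `SL(2, ℤ)` the function
`(c z + d) ^ (-κ / 2) * f (γ z)` is bounded as `Im z → ∞`. -/
def modularForms (κ : ℤ) (N : ℕ) : Submodule ℂ (ℍ → ℂ) where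
  carrier := {f | MDiff f ∧
    (∀ γ ∈ Gamma0 N, ∀ z : ℍ, f (γ • z) = autFactor κ γ z * f z) ∧
    (∀ γ : SL(2, ℤ), IsBoundedAtImInfty fun z : ℍ ↦
      ((γ 1 0 : ℂ) * (z : ℂ) + (γ 1 1 : ℂ)) ^ (-(κ : ℂ) / 2) * f (γ • z))}
  zero_mem' := by
    refine ⟨mdifferentiable_const, fun γ _ z ↦ by simp, fun γ ↦ ?_⟩
    simp only [Pi.zero_apply, mul_zero]
    exact Filter.const_boundedAtFilter atImInfty (0 : ℂ)
  add_mem' := by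
    rintro f g ⟨hf, hf', hf''⟩ ⟨hg, hg', hg''⟩
    refine ⟨hf.add hg, fun γ hγ z ↦ ?_, fun γ ↦ ?_⟩
    · simp only [Pi.add_apply, hf' γ hγ, hg' γ hγ, mul_add]
    · have := (hf'' γ).add (hg'' γ)
      refine this.congr_left fun z ↦ ?_
      simp only [Pi.add_apply, mul_add]
  smul_mem' := by
    rintro c f ⟨hf, hf', hf''⟩
    refine ⟨hf.const_smul c, fun γ hγ z ↦ ?_, fun γ ↦ ?_⟩
    · simp only [Pi.smul_apply, hf' γ hγ, smul_eq_mul]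
      ring
    · have := Filter.BoundedAtFilter.smul c (hf'' γ)
      refine this.congr_left fun z ↦ ?_
      simp only [Pi.smul_apply, smul_eq_mul]
      ring

/-- `G₂(z) = -1/24 + ∑_{n ≥ 1} σ₁(n) q ^ n`, where `q = exp (2 π i z)`; the series converges for
`Im z > 0`. -/
def eisG2 (z : ℂ) : ℂ :=
  -1 / 24 + ∑' n : ℕ+, (ArithmeticFunction.sigma 1 (n : ℕ) : ℂ)
    * Complex.exp (2 * Real.pi * Complex.I * z) ^ (n : ℕ)

/-- `θ(z) = ∑_{n ∈ ℤ} q ^ (n ^ 2)`, where `q = exp (2 π i z)`; the series converges for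
`Im z > 0`. -/
def theta (z : ℂ) : ℂ :=
  ∑' n : ℤ, Complex.exp (2 * Real.pi * Complex.I * z) ^ (n ^ 2)

/-- `f_m(z) = G₂(m z) θ(z) + θ'(z) / (2 π i m)` on the upper half plane. -/
def f (m : ℕ) (z : ℍ) : ℂ :=
  eisG2 (m * (z : ℂ)) * theta (z : ℂ)
    + 1 / (2 * Real.pi * Complex.I * m) * deriv theta (z : ℂ)

/-- The `n`-th Fourier coefficient `a_m(n)` of `f_m` (coefficient of `q ^ n` in the expansion in
`q = exp (2 π i z)`). -/
def a (m n : ℕ) : ℂ := (qExpansion 1 (f m)).coeff n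

end HalfIntegralWeight

end

/-!
By Jacobi's triple product, `θ(z) = ∑ q ^ (n ^ 2)` is the eta quotient
`η(2z) ^ 5 / (η(z) ^ 2 η(4z) ^ 2)` (`theta_mul_eta`). As `G₂` is, up to a constant, the
logarithmic derivative of `η`, taking logarithmic derivatives gives (`deriv_theta`)

  `θ' / (2 π i) = 2 θ(z) (G₂(z) - 5 G₂(2z) + 4 G₂(4z))`.

This is the asserted relation between `f 1`, `f 2` and `f 4`. It also shows that
`f m = θ * cofactor m`, where `cofactor m` is a linear combination of `G₂(z)`, `G₂(2z)` and `G₂(4z)`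
in which the quasimodular defects of `G₂` cancel (`cofactor_smul`). So modularity of `f m` follows
from Mathlib's transformation law of `E2` and from the transformation law of `θ` itself.

The triple product is obtained from its finite form `tsum_centralGauss`, an identity for Gaussian
binomial coefficients proved by induction, by dominated convergence.

The multiplier system of `θ` (`theta_smul`) comes from the inversion formula for the Jacobi theta
function: it gives the law for `(1, 0; 4, 1)`, which together with `T` and `-1` generates `Γ₀(4)`.
For the law to propagate, `autFactor 1` has to be compatible with these generators. For `T` this is
the periodicity of `(c / d)` in `d` modulo `c` (`kroneckerSym_add_self`), a form of quadratic
reciprocity in which the signs of `c` and `d` matter; for `(1, 0; 4, 1)` the sign conventions of the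
Kronecker symbol have to match the branch cut of the square root (`kroneckerSym_add_four_mul`,
`cpow_half_mul_cpow_half`).

Holomorphy at the cusps follows from the estimate `|f m z| ≤ C max(1, 1 / Im z) ^ (5 / 2)`
(`exists_norm_f_le`), whose exponent equals the weight: it is carried by any `γ` in `SL(2, ℤ)` to a
bound for `(c z + d) ^ (-5 / 2) f(γ z)` on vertical strips, and `Γ(4) ⊆ Γ₀(4)` makes the absolute
value of this function periodic.
-/

noncomputable section

namespace HalfIntegralWeight

/-! ### The triple product for the theta constant -/

section

open Filter Topology Finset

/-- The finite `q`-Pochhammer symbol `(Q; Q)_n = ∏_{i = 1}^n (1 - Q ^ i)`. -/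
def qPoch (Q : ℂ) (n : ℕ) : ℂ := ∏ i ∈ range n, (1 - Q ^ (i + 1))

/-- The reciprocal `1 / (Q; Q)_n`, extended by `0` to negative `n`. With this convention the
recursion `invQPoch_sub_one` holds for all integers, so that Gaussian binomial coefficients written
with `invQPoch` vanish outside their natural range and need no case distinctions. -/
def invQPoch (Q : ℂ) (n : ℤ) : ℂ := if n < 0 then 0 else (qPoch Q n.toNat)⁻¹

lemma one_sub_pow_succ_ne_zero {Q : ℂ} (hQ : ‖Q‖ < 1) (n : ℕ) : 1 - Q ^ (n + 1) ≠ 0 := by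
  intro h
  have h1 : ‖Q‖ ^ (n + 1) = 1 := by
    rw [← norm_pow, ← sub_eq_zero.mp h, norm_one]
  exact (pow_lt_one₀ (norm_nonneg Q) hQ (Nat.succ_ne_zero n)).ne h1

lemma qPoch_ne_zero {Q : ℂ} (hQ : ‖Q‖ < 1) (n : ℕ) : qPoch Q n ≠ 0 :=
  prod_ne_zero_iff.mpr fun i _ ↦ one_sub_pow_succ_ne_zero hQ i

lemma invQPoch_natCast (Q : ℂ) (n : ℕ) : invQPoch Q n = (qPoch Q n)⁻¹ := by
  simp [invQPoch]

lemma invQPoch_of_neg (Q : ℂ) {n : ℤ} (hn : n < 0) : invQPoch Q n = 0 := if_pos hn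

lemma invQPoch_sub_one {Q : ℂ} (hQ : ‖Q‖ < 1) (n : ℤ) :
    invQPoch Q (n - 1) = (1 - Q ^ n) * invQPoch Q n := by
  rcases lt_trichotomy n 0 with hn | rfl | hn
  · rw [invQPoch_of_neg Q hn, invQPoch_of_neg Q (by omega), mul_zero]
  · simp [invQPoch]
  · obtain ⟨k, rfl⟩ : ∃ k : ℕ, n = (k + 1 : ℕ) := ⟨(n - 1).toNat, by omega⟩
    have h : ((k + 1 : ℕ) : ℤ) - 1 = (k : ℕ) := by push_cast; ring
    rw [h, invQPoch_natCast, invQPoch_natCast, zpow_natCast, qPoch, qPoch, prod_range_succ]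
    have := one_sub_pow_succ_ne_zero hQ k
    have := qPoch_ne_zero hQ k
    rw [qPoch] at this
    field_simp

/-- The centred Gaussian binomial coefficient `[2N choose N + k]` in base `Q`. -/
def centralGauss (Q : ℂ) (N : ℕ) (k : ℤ) : ℂ :=
  qPoch Q (2 * N) * invQPoch Q (N + k) * invQPoch Q (N - k)

lemma centralGauss_eq_zero (Q : ℂ) {N : ℕ} {k : ℤ} (hk : N < |k|) : centralGauss Q N k = 0 := by
  rcases lt_abs.mp hk with h | h
  · rw [centralGauss, invQPoch_of_neg Q (n := N - k) (by omega), mul_zero]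
  · rw [centralGauss, invQPoch_of_neg Q (n := N + k) (by omega), mul_zero, zero_mul]

/-- The recursion which the factor `(1 + q ^ (2N + 1)) ^ 2` imposes on the coefficients of the
finite triple product. -/
lemma centralGauss_succ {q : ℂ} (hq0 : q ≠ 0) (hq : ‖q‖ < 1) (N : ℕ) (k : ℤ) :
    centralGauss (q ^ 2) (N + 1) k * q ^ (k ^ 2) =
      (1 + q ^ (4 * N + 2)) * (centralGauss (q ^ 2) N k * q ^ (k ^ 2))
      + q ^ (2 * N + 1) * (centralGauss (q ^ 2) N (k - 1) * q ^ ((k - 1) ^ 2))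
      + q ^ (2 * N + 1) * (centralGauss (q ^ 2) N (k + 1) * q ^ ((k + 1) ^ 2)) := by
  set Q := q ^ 2 with hQdef
  have hQ : ‖Q‖ < 1 := by
    rw [hQdef, norm_pow]; exact pow_lt_one₀ (norm_nonneg q) hq two_ne_zero
  have hQ0 : Q ≠ 0 := pow_ne_zero 2 hq0
  have h2 : 2 * (N + 1) = 2 * N + 1 + 1 := by ring
  -- everything is expressed through the two reciprocals occurring on the left-hand side
  have e1 : invQPoch Q (N + k) = (1 - Q ^ (N + 1 + k)) * invQPoch Q (N + 1 + k) := by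
    rw [← invQPoch_sub_one hQ]; congr 1; ring
  have e2 : invQPoch Q (N + (k - 1)) = (1 - Q ^ (N + k)) * invQPoch Q (N + k) := by
    rw [← invQPoch_sub_one hQ]; congr 1; ring
  have e3 : invQPoch Q (N - k) = (1 - Q ^ (N + 1 - k)) * invQPoch Q (N + 1 - k) := by
    rw [← invQPoch_sub_one hQ]; congr 1; ring
  have e4 : invQPoch Q (N - (k + 1)) = (1 - Q ^ (N - k)) * invQPoch Q (N - k) := by
    rw [← invQPoch_sub_one hQ]; congr 1; ring
  have e5 : (N : ℤ) + (k + 1) = N + 1 + k := by ring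
  have e6 : (N : ℤ) - (k - 1) = N + 1 - k := by ring
  have p1 : q ^ ((k - 1) ^ 2) = q ^ (k ^ 2) * (Q ^ k)⁻¹ * q := by
    rw [hQdef, ← zpow_natCast, ← zpow_mul, ← zpow_neg, ← zpow_add₀ hq0, ← zpow_add_one₀ hq0]
    congr 1; push_cast; ring
  have p2 : q ^ ((k + 1) ^ 2) = q ^ (k ^ 2) * Q ^ k * q := by
    rw [hQdef, ← zpow_natCast, ← zpow_mul, ← zpow_add₀ hq0, ← zpow_add_one₀ hq0]
    congr 1; push_cast; ring
  have p3 : q ^ (2 * N + 1) * q = Q ^ N * Q := by rw [hQdef]; ring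
  have p4 : q ^ (4 * N + 2) = (Q ^ N) ^ 2 * Q := by rw [hQdef]; ring
  have hk : Q ^ k ≠ 0 := zpow_ne_zero k hQ0
  simp only [centralGauss, h2, qPoch, prod_range_succ, Nat.cast_add, Nat.cast_one]
  rw [e5, e6, e2, e4, e1, e3, p1, p2, p4]
  have z1 : Q ^ ((N : ℤ) + 1 + k) = Q ^ N * Q * Q ^ k := by
    rw [zpow_add₀ hQ0, zpow_add_one₀ hQ0, zpow_natCast]
  have z2 : Q ^ ((N : ℤ) + k) = Q ^ N * Q ^ k := by rw [zpow_add₀ hQ0, zpow_natCast]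
  have z3 : Q ^ ((N : ℤ) + 1 - k) = Q ^ N * Q * (Q ^ k)⁻¹ := by
    rw [sub_eq_add_neg, zpow_add₀ hQ0, zpow_add_one₀ hQ0, zpow_natCast, zpow_neg]
  have z4 : Q ^ ((N : ℤ) - k) = Q ^ N * (Q ^ k)⁻¹ := by
    rw [sub_eq_add_neg, zpow_add₀ hQ0, zpow_natCast, zpow_neg]
  have z5 : Q ^ (2 * N + 1) = (Q ^ N) ^ 2 * Q := by ring
  have z6 : Q ^ (2 * N + 1 + 1) = (Q ^ N) ^ 2 * Q * Q := by ring
  rw [z1, z2, z3, z4, z5, z6]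
  clear_value Q
  generalize invQPoch Q (N + 1 + k) = r
  generalize invQPoch Q (N + 1 - k) = s
  generalize ∏ x ∈ range (2 * N), (1 - Q ^ (x + 1)) = p
  generalize q ^ (k ^ 2) = w
  generalize Q ^ k = v at *
  generalize Q ^ N = u at *
  linear_combination (norm := (field_simp; ring))
    (-(p * w * r * s) * (v⁻¹ * ((1 - u * v) * (1 - u * Q * v)) +
      v * ((1 - u * v⁻¹) * (1 - u * Q * v⁻¹)))) * p3

/-- **Jacobi's triple product**, finite form at `z = 1`. -/
lemma tsum_centralGauss {q : ℂ} (hq0 : q ≠ 0) (hq : ‖q‖ < 1) (N : ℕ) :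
    ∑' k : ℤ, centralGauss (q ^ 2) N k * q ^ (k ^ 2) =
      (∏ m ∈ range N, (1 + q ^ (2 * m + 1))) ^ 2 := by
  have hs (N : ℕ) : Summable fun k : ℤ ↦ centralGauss (q ^ 2) N k * q ^ (k ^ 2) := by
    refine summable_of_hasFiniteSupport ((Set.finite_Icc (-N : ℤ) N).subset fun k hk ↦ ?_)
    by_contra h
    refine hk ?_
    have h' : (N : ℤ) < |k| := by
      rw [Set.mem_Icc, ← abs_le] at h; exact not_le.mp h
    simp only [centralGauss_eq_zero _ h', zero_mul]
  induction N with
  | zero =>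
    rw [tsum_eq_single 0]
    · simp [centralGauss, invQPoch, qPoch]
    · intro k hk
      rw [centralGauss_eq_zero _ (by simpa using hk), zero_mul]
  | succ N ih =>
    have hs1 : Summable fun k : ℤ ↦ centralGauss (q ^ 2) N (k - 1) * q ^ ((k - 1) ^ 2) :=
      (hs N).comp_injective (Equiv.subRight (1 : ℤ)).injective
    have hs2 : Summable fun k : ℤ ↦ centralGauss (q ^ 2) N (k + 1) * q ^ ((k + 1) ^ 2) :=
      (hs N).comp_injective (Equiv.addRight (1 : ℤ)).injective
    have t1 := (Equiv.subRight (1 : ℤ)).tsum_eq (fun k ↦ centralGauss (q ^ 2) N k * q ^ (k ^ 2))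
    have t2 := (Equiv.addRight (1 : ℤ)).tsum_eq (fun k ↦ centralGauss (q ^ 2) N k * q ^ (k ^ 2))
    simp only [Equiv.subRight_apply, Equiv.coe_addRight] at t1 t2
    simp_rw [centralGauss_succ hq0 hq]
    rw [(((hs N).mul_left _).add (hs1.mul_left _)).tsum_add (hs2.mul_left _),
      ((hs N).mul_left _).tsum_add (hs1.mul_left _), tsum_mul_left, tsum_mul_left, tsum_mul_left,
      t1, t2, ih, prod_range_succ]
    ring

/-- Euler's function `∏_{n ≥ 1} (1 - Q ^ n)`, the limit of the `q`-Pochhammer symbols. -/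
def eulerProd (Q : ℂ) : ℂ := ∏' n : ℕ, (1 - Q ^ (n + 1))

lemma tendsto_qPoch {Q : ℂ} (hQ : ‖Q‖ < 1) :
    Tendsto (qPoch Q) atTop (𝓝 (eulerProd Q)) :=
  (ModularForm.multipliable_one_sub_pow hQ).tendsto_prod_tprod_nat

lemma eulerProd_ne_zero {Q : ℂ} (hQ : ‖Q‖ < 1) : eulerProd Q ≠ 0 := by
  refine tprod_one_add_ne_zero_of_summable (f := fun n ↦ -Q ^ (n + 1)) (fun n ↦ ?_) ?_
  · simpa [sub_eq_add_neg] using one_sub_pow_succ_ne_zero hQ n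
  · simpa using (summable_nat_add_iff 1).mpr (summable_geometric_of_lt_one (norm_nonneg _) hQ)

/-- The Gaussian binomial coefficients in the finite triple product are bounded uniformly in `N`
and `k`. -/
lemma exists_norm_centralGauss_le {Q : ℂ} (hQ : ‖Q‖ < 1) :
    ∃ C, ∀ N k, ‖centralGauss Q N k‖ ≤ C := by
  obtain ⟨A, hA⟩ := (Metric.isBounded_range_of_tendsto _ (tendsto_qPoch hQ)).exists_norm_le
  obtain ⟨B, hB⟩ := (Metric.isBounded_range_of_tendsto _
    ((tendsto_qPoch hQ).inv₀ (eulerProd_ne_zero hQ))).exists_norm_le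
  have hA0 : 0 ≤ A := (norm_nonneg _).trans (hA _ ⟨0, rfl⟩)
  have hB0 : 0 ≤ B := (norm_nonneg _).trans (hB _ ⟨0, rfl⟩)
  have hr (n : ℤ) : ‖invQPoch Q n‖ ≤ B := by
    rw [invQPoch]
    split_ifs
    · simpa using hB0
    · exact hB _ ⟨n.toNat, rfl⟩
  refine ⟨A * B * B, fun N k ↦ ?_⟩
  rw [centralGauss, norm_mul, norm_mul]
  gcongr
  exacts [hA _ ⟨2 * N, rfl⟩, hr _, hr _]

lemma tendsto_centralGauss {Q : ℂ} (hQ : ‖Q‖ < 1) (k : ℤ) :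
    Tendsto (fun N ↦ centralGauss Q N k) atTop (𝓝 (eulerProd Q)⁻¹) := by
  have hE := eulerProd_ne_zero hQ
  have h1 : Tendsto (fun N : ℕ ↦ qPoch Q (2 * N)) atTop (𝓝 (eulerProd Q)) :=
    (tendsto_qPoch hQ).comp (tendsto_id.const_mul_atTop' two_pos)
  have h2 (k : ℤ) : Tendsto (fun N : ℕ ↦ invQPoch Q (N + k)) atTop (𝓝 (eulerProd Q)⁻¹) := by
    have hlim : Tendsto (fun N : ℕ ↦ ((N : ℤ) + k).toNat) atTop atTop :=
      tendsto_atTop.mpr fun b ↦ (eventually_ge_atTop (b + k.natAbs)).mono fun N hN ↦ by omega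
    refine (((tendsto_qPoch hQ).inv₀ hE).comp hlim).congr' ?_
    filter_upwards [eventually_ge_atTop k.natAbs] with N hN
    rw [invQPoch, if_neg (by omega), Function.comp_apply]
  have := (h1.mul (h2 k)).mul (h2 (-k))
  rw [mul_inv_cancel₀ hE, one_mul] at this
  simpa only [centralGauss, sub_eq_add_neg] using this

lemma summable_norm_pow_sq {q : ℂ} (hq : ‖q‖ < 1) : Summable fun k : ℤ ↦ ‖q ^ (k ^ 2)‖ := by
  have h : Summable fun n : ℕ ↦ ‖q‖ ^ (n ^ 2) :=
    Summable.of_nonneg_of_le (fun n ↦ by positivity)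
      (fun n ↦ pow_le_pow_of_le_one (norm_nonneg q) hq.le (Nat.le_self_pow two_ne_zero n))
      (summable_geometric_of_lt_one (norm_nonneg q) hq)
  have hc (n : ℕ) : ‖q‖ ^ (n ^ 2) = ‖q ^ ((n : ℤ) ^ 2)‖ := by
    rw [← norm_pow]
    norm_cast
  exact Summable.of_nat_of_neg (h.congr hc) (h.congr fun n ↦ by rw [neg_sq, hc])

/-- The odd part of the triple product, as a quotient of Pochhammer symbols: this is
`(1 + q ^ n) = (1 - q ^ (2n)) / (1 - q ^ n)` for odd `n`. -/
lemma prod_one_add_odd_pow_mul (q : ℂ) (N : ℕ) :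
    (∏ m ∈ range N, (1 + q ^ (2 * m + 1))) * (qPoch q (2 * N) * qPoch (q ^ 4) N) =
      qPoch (q ^ 2) N * qPoch (q ^ 2) (2 * N) := by
  induction N with
  | zero => simp [qPoch]
  | succ N ih =>
    have h2 : 2 * (N + 1) = 2 * N + 1 + 1 := by ring
    simp only [qPoch, h2, prod_range_succ] at ih ⊢
    linear_combination (1 + q ^ (2 * N + 1)) * (1 - q ^ (2 * N + 1)) *
      (1 - q ^ (2 * N + 1 + 1)) * (1 - (q ^ 4) ^ (N + 1)) * ih

/-- Jacobi's product for the theta constant `∑ q ^ (k ^ 2)`. -/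
theorem tsum_pow_sq_mul_eulerProd {q : ℂ} (hq0 : q ≠ 0) (hq : ‖q‖ < 1) :
    (∑' k : ℤ, q ^ (k ^ 2)) * (eulerProd q ^ 2 * eulerProd (q ^ 4) ^ 2) =
      eulerProd (q ^ 2) ^ 5 := by
  have hlt {n : ℕ} (hn : n ≠ 0) : ‖q ^ n‖ < 1 := by
    rw [norm_pow]; exact pow_lt_one₀ (norm_nonneg q) hq hn
  have hq2 := hlt two_ne_zero
  have hq4 := hlt four_ne_zero
  obtain ⟨C, hC⟩ := exists_norm_centralGauss_le hq2
  have hlim : Tendsto (fun N ↦ ∑' k : ℤ, centralGauss (q ^ 2) N k * q ^ (k ^ 2)) atTop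
      (𝓝 (∑' k : ℤ, (eulerProd (q ^ 2))⁻¹ * q ^ (k ^ 2))) := by
    refine tendsto_tsum_of_dominated_convergence ((summable_norm_pow_sq hq).mul_left C)
      (fun k ↦ (tendsto_centralGauss hq2 k).mul_const _) (.of_forall fun N k ↦ ?_)
    rw [norm_mul]
    gcongr
    exact hC N k
  rw [tsum_mul_left] at hlim
  have two {Q : ℂ} (hQ : ‖Q‖ < 1) : Tendsto (fun N : ℕ ↦ qPoch Q (2 * N)) atTop
      (𝓝 (eulerProd Q)) := (tendsto_qPoch hQ).comp (tendsto_id.const_mul_atTop' two_pos)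
  have hL := hlim.mul (((two hq).mul (tendsto_qPoch hq4)).pow 2)
  have hR := ((tendsto_qPoch hq2).mul (two hq2)).pow 2
  have key := tendsto_nhds_unique (hL.congr fun N ↦ by
    rw [tsum_centralGauss hq0 hq, ← mul_pow, prod_one_add_odd_pow_mul]) hR
  have hE := eulerProd_ne_zero hq2
  field_simp at key
  linear_combination key

end

/-! ### The theta function as an eta quotient -/

section

open Filter Topology UpperHalfPlane ModularForm EisensteinSeries CongruenceSubgroup
open scoped MatrixGroups Manifold

lemma theta_eq_jacobiTheta (z : ℂ) : theta z = jacobiTheta (2 * z) := by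
  refine tsum_congr fun n ↦ ?_
  rw [← Complex.exp_int_mul]
  congr 1
  push_cast
  ring

lemma two_mul_im_pos {z : ℂ} (hz : 0 < z.im) : 0 < (2 * z).im := by
  simpa using hz

lemma differentiableAt_theta {z : ℂ} (hz : 0 < z.im) : DifferentiableAt ℂ theta z := by
  have h : theta = jacobiTheta ∘ fun z ↦ 2 * z := funext theta_eq_jacobiTheta
  rw [h]
  exact (differentiableAt_jacobiTheta (two_mul_im_pos hz)).comp z (by fun_prop)

lemma theta_add_one (z : ℂ) : theta (z + 1) = theta z := by
  rw [theta_eq_jacobiTheta, theta_eq_jacobiTheta, mul_add, mul_one, add_comm, jacobiTheta_two_add]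

lemma eta_eq_eulerProd (z : ℂ) :
    η z = Function.Periodic.qParam 24 z *
      eulerProd (Complex.exp (2 * Real.pi * Complex.I * z)) := by
  simp [eta, eulerProd, eta_q_eq_pow]

/-- The theta function as an eta quotient: `θ(z) = η(2z) ^ 5 / (η(z) ^ 2 η(4z) ^ 2)`. -/
theorem theta_mul_eta {z : ℂ} (hz : 0 < z.im) :
    theta z * (η z ^ 2 * η (4 * z) ^ 2) = η (2 * z) ^ 5 := by
  set q := Complex.exp (2 * Real.pi * Complex.I * z) with hq
  have h2 : Complex.exp (2 * Real.pi * Complex.I * (2 * z)) = q ^ 2 := by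
    rw [hq, ← Complex.exp_nat_mul]; congr 1; push_cast; ring
  have h4 : Complex.exp (2 * Real.pi * Complex.I * (4 * z)) = q ^ 4 := by
    rw [hq, ← Complex.exp_nat_mul]; congr 1; push_cast; ring
  have p2 : Function.Periodic.qParam 24 (2 * z) = Function.Periodic.qParam 24 z ^ 2 := by
    rw [Function.Periodic.qParam, Function.Periodic.qParam, ← Complex.exp_nat_mul]
    congr 1; push_cast; ring
  have p4 : Function.Periodic.qParam 24 (4 * z) = Function.Periodic.qParam 24 z ^ 4 := by
    rw [Function.Periodic.qParam, Function.Periodic.qParam, ← Complex.exp_nat_mul]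
    congr 1; push_cast; ring
  have hlt : ‖q‖ < 1 := norm_exp_two_pi_I_lt_one ⟨z, hz⟩
  have key := tsum_pow_sq_mul_eulerProd (Complex.exp_ne_zero _) hlt
  rw [eta_eq_eulerProd, eta_eq_eulerProd, eta_eq_eulerProd, h2, h4, p2, p4, ← hq]
  change theta z * _ = _ at key
  linear_combination Function.Periodic.qParam 24 z ^ 10 * key

/-- The point `k z` of the upper half plane, for a positive integer `k`. -/
def natMul (k : ℕ) [NeZero k] (z : ℍ) : ℍ :=
  ⟨k * (z : ℂ), by
    have : (0 : ℝ) < k := Nat.cast_pos.mpr (NeZero.pos k)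
    simpa using mul_pos this z.im_pos⟩

@[simp]
lemma coe_natMul (k : ℕ) [NeZero k] (z : ℍ) : (natMul k z : ℂ) = k * (z : ℂ) := rfl

/-! ### The Eisenstein series of weight two and the derivative of the theta function -/

lemma eisG2_eq (z : ℍ) : eisG2 z = -(1 / 24) * E2 z := by
  rw [E2_eq_tsum_cexp, eisG2]
  ring

lemma differentiableAt_eisG2 {z : ℂ} (hz : 0 < z.im) : DifferentiableAt ℂ eisG2 z := by
  have h := UpperHalfPlane.mdifferentiableAt_iff.mp (E2_mdifferentiable ⟨z, hz⟩)
  refine (h.const_mul (-(1 / 24))).congr_of_eventuallyEq ?_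
  filter_upwards [isOpen_upperHalfPlaneSet.mem_nhds hz] with w hw
  rw [Function.comp_apply, ofComplex_apply_of_im_pos hw, ← eisG2_eq]

lemma eisG2_add_one (z : ℂ) : eisG2 (z + 1) = eisG2 z := by
  have h : Complex.exp (2 * Real.pi * Complex.I * (z + 1)) =
      Complex.exp (2 * Real.pi * Complex.I * z) := by
    rw [mul_add, mul_one, Complex.exp_add, Complex.exp_two_pi_mul_I, mul_one]
  simp only [eisG2, h]

lemma eisG2_natMul_add_one (k : ℕ) (z : ℂ) : eisG2 (k * (z + 1)) = eisG2 (k * z) := by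
  have h (n : ℕ) : eisG2 (k * z + n) = eisG2 (k * z) := by
    induction n with
    | zero => simp
    | succ n ih => rw [Nat.cast_succ, ← add_assoc, eisG2_add_one, ih]
  rw [mul_add, mul_one, h]

/-- The logarithmic derivative of the eta quotient for `θ`. -/
theorem deriv_theta {z : ℂ} (hz : 0 < z.im) :
    deriv theta z = 2 * Real.pi * Complex.I *
      (theta z * (2 * (eisG2 z - 5 * eisG2 (2 * z) + 4 * eisG2 (4 * z)))) := by
  have him {k : ℕ} (hk : 0 < k) : 0 < ((k : ℂ) * z).im := by
    have : (0 : ℝ) < k := Nat.cast_pos.mpr hk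
    simpa using mul_pos this hz
  have him2 := him two_pos
  have him4 := him four_pos
  have h1 : η z ≠ 0 := eta_ne_zero hz
  have h2 : η (2 * z) ≠ 0 := eta_ne_zero him2
  have h4 : η (4 * z) ≠ 0 := eta_ne_zero him4
  have hθ := theta_mul_eta hz
  have logd {w : ℂ} (hw : 0 < w.im) :
      HasDerivAt η (η w * (-(2 * Real.pi * Complex.I) * eisG2 w)) w := by
    have h := logDeriv_eta_eq_E2 ⟨w, hw⟩
    have hd := differentiableAt_eta_of_mem_upperHalfPlaneSet hw
    have hne : η w ≠ 0 := eta_ne_zero hw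
    rw [logDeriv_apply, div_eq_iff hne] at h
    have h' : eisG2 w = -(1 / 24) * E2 ⟨w, hw⟩ := eisG2_eq ⟨w, hw⟩
    have e : deriv η w = η w * (-(2 * Real.pi * Complex.I) * eisG2 w) := by
      rw [h']
      linear_combination h
    exact e ▸ hd.hasDerivAt
  have d1 := logd hz
  have d2 := (logd him2).comp z ((hasDerivAt_id z).const_mul _)
  have d4 := (logd him4).comp z ((hasDerivAt_id z).const_mul _)
  have dL := (differentiableAt_theta hz).hasDerivAt.mul ((d1.pow 2).mul (d4.pow 2))
  have dR := d2.pow 5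
  have heq : (theta * (η ^ 2 * (η ∘ fun y ↦ ((4 : ℕ) : ℂ) * id y) ^ 2)) =ᶠ[𝓝 z]
      (η ∘ fun y ↦ ((2 : ℕ) : ℂ) * id y) ^ 5 := by
    filter_upwards [isOpen_upperHalfPlaneSet.mem_nhds hz] with w hw
    simpa using theta_mul_eta hw
  have key := (dL.congr_of_eventuallyEq heq.symm).unique dR
  simp only [Pi.pow_apply, Pi.mul_apply, Function.comp_apply, Nat.cast_ofNat] at key
  have hne : η z ^ 2 * η (4 * z) ^ 2 ≠ 0 := by positivity
  refine mul_right_cancel₀ hne ?_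
  linear_combination key + 20 * Real.pi * Complex.I * eisG2 (2 * z) * hθ

/-- The cofactor of `θ` in `f m`: since `θ'` is a multiple of `θ`, one has `f m = θ * cofactor m`,
where `cofactor m` is an Eisenstein series of weight `2` on `Γ₀(4)`. -/
def cofactor (m : ℕ) (z : ℂ) : ℂ :=
  eisG2 (m * z) + 2 / m * (eisG2 z - 5 * eisG2 (2 * z) + 4 * eisG2 (4 * z))

lemma f_eq (m : ℕ) (z : ℍ) : f m z = theta z * cofactor m z := by
  have hpi : (Real.pi : ℂ) ≠ 0 := Complex.ofReal_ne_zero.mpr Real.pi_ne_zero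
  rw [f, cofactor, deriv_theta z.im_pos]
  rcases eq_or_ne (m : ℂ) 0 with hm | hm
  · simp [hm]; ring
  · field_simp [Complex.I_ne_zero]

theorem f_one_sub_f_two_add_f_four : f 1 - (5 : ℂ) • f 2 + (4 : ℂ) • f 4 = 0 := by
  ext z
  simp only [Pi.add_apply, Pi.sub_apply, Pi.smul_apply, smul_eq_mul, Pi.zero_apply, f_eq, cofactor]
  push_cast
  rw [one_mul]
  ring

/-! ### Transformation of the Eisenstein factor -/

/-- Quasimodularity of `G₂`. -/
lemma eisG2_smul (γ : SL(2, ℤ)) (z : ℍ) :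
    eisG2 (γ • z : ℍ) = ((γ 1 0 : ℂ) * z + γ 1 1) ^ 2 * eisG2 z
      - γ 1 0 * ((γ 1 0 : ℂ) * z + γ 1 1) / (4 * Real.pi * Complex.I) := by
  have h := congr_fun (E2_slash_action γ) z
  have hpi : (Real.pi : ℂ) ≠ 0 := Complex.ofReal_ne_zero.mpr Real.pi_ne_zero
  have hd : (γ 1 0 : ℂ) * z + γ 1 1 ≠ 0 := by
    rw [← ModularGroup.denom_apply]; exact denom_ne_zero γ z
  rw [SL_slash_apply, Pi.sub_apply, Pi.smul_apply, D2, ModularGroup.denom_apply, riemannZeta_two,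
    smul_eq_mul, zpow_neg, ← div_eq_mul_inv, div_eq_iff (zpow_ne_zero 2 hd), zpow_ofNat] at h
  rw [eisG2_eq, eisG2_eq, h]
  field_simp
  linear_combination 24 * (γ 1 0 : ℂ) * Complex.I_sq

lemma eisG2_natMul_smul {γ : SL(2, ℤ)} (k : ℕ) [NeZero k] (hγ : (k : ℤ) ∣ γ 1 0) (z : ℍ) :
    eisG2 (k * (γ • z : ℍ)) = ((γ 1 0 : ℂ) * z + γ 1 1) ^ 2 * eisG2 (k * z)
      - γ 1 0 / k * ((γ 1 0 : ℂ) * z + γ 1 1) / (4 * Real.pi * Complex.I) := by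
  obtain ⟨c, hc⟩ := hγ
  have hk : (k : ℂ) ≠ 0 := NeZero.ne _
  have hdet := Matrix.SpecialLinearGroup.det_coe γ
  rw [Matrix.det_fin_two] at hdet
  let δ : SL(2, ℤ) := ⟨!![γ 0 0, k * γ 0 1; c, γ 1 1], by
    rw [Matrix.det_fin_two_of]; linear_combination hdet + γ 0 1 * hc⟩
  have hz : δ • natMul k z = natMul k (γ • z) := by
    ext
    rw [coe_natMul, UpperHalfPlane.coe_specialLinearGroup_apply,
      UpperHalfPlane.coe_specialLinearGroup_apply]
    simp [δ, hc]
    field_simp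
  have h := eisG2_smul δ (natMul k z)
  rw [hz] at h
  simp only [coe_natMul] at h
  rw [h]
  simp [δ, hc]
  field_simp

/-- The quasimodular defects cancel in the cofactors, leaving weight `2` on `Γ₀(4)`. -/
lemma cofactor_smul {m : ℕ} (hm : m ∈ ({1, 2, 4} : Set ℕ)) {γ : SL(2, ℤ)} (hγ : γ ∈ Gamma0 4)
    (z : ℍ) : cofactor m (γ • z : ℍ) = ((γ 1 0 : ℂ) * z + γ 1 1) ^ 2 * cofactor m z := by
  have h4 : ((4 : ℕ) : ℤ) ∣ γ 1 0 := by
    rw [← ZMod.intCast_zmod_eq_zero_iff_dvd]; exact Gamma0_mem.mp hγ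
  have e1 := eisG2_smul γ z
  have e2 := eisG2_natMul_smul 2 ((by norm_num : ((2 : ℕ) : ℤ) ∣ (4 : ℕ)).trans h4) z
  have e4 := eisG2_natMul_smul 4 h4 z
  push_cast at e2 e4
  rcases hm with rfl | rfl | rfl <;> simp only [cofactor] <;> push_cast <;>
    rw [e1, e2, e4]
  · rw [one_mul, one_mul, e1]; ring
  · ring
  · ring

end

/-! ### The Kronecker symbol -/

section

open Filter Topology UpperHalfPlane CongruenceSubgroup
open scoped MatrixGroups

lemma kroneckerSym_of_odd (c : ℤ) {d : ℤ} (hd : Odd d) :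
    kroneckerSym c d = (if c < 0 ∧ d < 0 then -1 else 1) * jacobiSym c d.natAbs := by
  have hd0 : d ≠ 0 := by rintro rfl; simp at hd
  have hv : padicValNat 2 d.natAbs = 0 := by
    refine padicValNat.eq_zero_of_not_dvd fun h ↦ ?_
    exact Int.not_even_iff_odd.mpr hd (even_iff_two_dvd.mpr (Int.natCast_dvd.mpr h))
  simp [kroneckerSym, hd0, hv]

lemma jacobiSym_four_mul (a : ℤ) {n : ℕ} (hn : Odd n) : jacobiSym (4 * a) n = jacobiSym a n := by
  have h : jacobiSym (2 ^ 2) n = 1 :=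
    jacobiSym.sq_one' (by simpa [Int.gcd, Nat.coprime_iff_gcd_eq_one] using hn)
  rw [jacobiSym.mul_left, show (4 : ℤ) = 2 ^ 2 by norm_num, h, one_mul]

lemma jacobiSym_add_four_mul_natAbs (a : ℤ) {n : ℕ} (hn : Odd n) :
    jacobiSym a (n + 4 * a.natAbs) = jacobiSym a n := by
  have hn' : Odd (n + 4 * a.natAbs) := hn.add_even ⟨2 * a.natAbs, by ring⟩
  rw [jacobiSym.mod_right a hn', Nat.add_mod_right, ← jacobiSym.mod_right a hn]

/-- The reflection `n ↦ 4 |a| - n` multiplies the Jacobi symbol `(a / n)` by the sign of `a`. It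
acts modulo `4 |a|` as multiplication by `4 |a| - 1`, and `(4 |a| / 4 |a| - 1) = 1`. -/
lemma jacobiSym_reflect {a : ℤ} {n n' : ℕ} (hn : Odd n) (h : n + n' = 4 * a.natAbs) :
    jacobiSym a n' = (if a < 0 then -1 else 1) * jacobiSym a n := by
  obtain ⟨m, hm⟩ : ∃ m, a.natAbs = m + 1 :=
    ⟨a.natAbs - 1, by have := hn.pos; omega⟩
  have hodd : Odd (4 * m + 3) := ⟨2 * m + 1, by ring⟩
  have habs : jacobiSym a.natAbs (4 * m + 3) = 1 := by
    rw [← jacobiSym_four_mul _ hodd, jacobiSym.mod_left]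
    have : 4 * (a.natAbs : ℤ) % ((4 * m + 3 : ℕ) : ℤ) = 1 % ((4 * m + 3 : ℕ) : ℤ) := by
      rw [hm]
      push_cast
      rw [show (4 : ℤ) * (m + 1) = 1 + (4 * m + 3) by ring, Int.add_emod_right]
    rw [this, ← jacobiSym.mod_left, jacobiSym.one_left]
  have hsign : jacobiSym a (4 * m + 3) = if a < 0 then -1 else 1 := by
    split_ifs with ha
    · have ha' : a = -(a.natAbs : ℤ) := by omega
      rw [ha', jacobiSym.neg _ hodd, habs, mul_one, ZMod.χ₄_nat_three_mod_four (by omega)]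
    · have ha' : a = (a.natAbs : ℤ) := by omega
      rw [ha', habs]
  have hn' : Odd n' := by
    rcases hn with ⟨k, rfl⟩
    exact ⟨2 * a.natAbs - k - 1, by omega⟩
  have hmul : jacobiSym a n' = jacobiSym a ((4 * m + 3) * n) := by
    rw [jacobiSym.mod_right a hn', jacobiSym.mod_right a (hodd.mul hn)]
    congr 1
    refine Nat.ModEq.add_right_cancel' n (?_ : n' + n ≡ (4 * m + 3) * n + n [MOD 4 * a.natAbs])
    have e1 : n' + n = 4 * a.natAbs * 1 := by omega
    have e2 : (4 * m + 3) * n + n = 4 * a.natAbs * n := by rw [hm]; ring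
    rw [e1, e2]
    exact (Nat.mul_mod_right _ _).trans (Nat.mul_mod_right _ _).symm
  have : NeZero n := ⟨hn.pos.ne'⟩
  rw [hmul, jacobiSym.mul_right, hsign]

lemma kroneckerSym_add_self {c d : ℤ} (hc : 4 ∣ c) (hd : Odd d) :
    kroneckerSym c (c + d) = kroneckerSym c d := by
  obtain ⟨a, rfl⟩ := hc
  have hcd : Odd (4 * a + d) := Even.add_odd ⟨2 * a, by ring⟩ hd
  have hn := Int.natAbs_odd.mpr hd
  have hn' := Int.natAbs_odd.mpr hcd
  rw [kroneckerSym_of_odd _ hd, kroneckerSym_of_odd _ hcd, jacobiSym_four_mul _ hn,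
    jacobiSym_four_mul _ hn']
  have hd0 : d ≠ 0 := by rintro rfl; simp at hd
  have hcd0 : 4 * a + d ≠ 0 := fun h ↦ by simp [h] at hcd
  rcases lt_or_ge d 0 with h1 | h1 <;> rcases lt_or_ge (4 * a + d) 0 with h2 | h2
  · have : jacobiSym a (4 * a + d).natAbs = jacobiSym a d.natAbs := by
      rcases le_or_gt a 0 with ha | ha
      · rw [show (4 * a + d).natAbs = d.natAbs + 4 * a.natAbs by omega,
          jacobiSym_add_four_mul_natAbs a hn]
      · rw [show d.natAbs = (4 * a + d).natAbs + 4 * a.natAbs by omega,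
          jacobiSym_add_four_mul_natAbs a hn']
    simp [h1, h2, this]
  · have h := jacobiSym_reflect (a := a) (n' := (4 * a + d).natAbs) hn (by omega)
    rw [h, if_neg (by omega : ¬ a < 0), if_neg (by omega), if_neg (by omega), one_mul]
  · have h := jacobiSym_reflect (a := a) (n' := (4 * a + d).natAbs) hn (by omega)
    rw [h, if_pos (by omega : a < 0), if_pos (by omega), if_neg (by omega)]
    ring
  · have : jacobiSym a (4 * a + d).natAbs = jacobiSym a d.natAbs := by
      rcases le_or_gt 0 a with ha | ha
      · rw [show (4 * a + d).natAbs = d.natAbs + 4 * a.natAbs by omega,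
          jacobiSym_add_four_mul_natAbs a hn]
      · rw [show d.natAbs = (4 * a + d).natAbs + 4 * a.natAbs by omega,
          jacobiSym_add_four_mul_natAbs a hn']
    rw [this, if_neg (by omega), if_neg (by omega)]

/-- The Kronecker symbol `(c / d)` is periodic in `c` up to a sign for negative `d`; this sign is
the one by which the principal square root fails to be a cocycle, see `cpow_half_mul_cpow_half`. -/
lemma kroneckerSym_add_four_mul (c : ℤ) {d : ℤ} (hd : Odd d) :
    kroneckerSym (c + 4 * d) d = (if 0 ≤ c ∧ c + 4 * d < 0 then -1 else 1) * kroneckerSym c d := by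
  have hJ : jacobiSym (c + 4 * d) d.natAbs = jacobiSym c d.natAbs := by
    rw [jacobiSym.mod_left, jacobiSym.mod_left c]
    congr 1
    refine Int.ModEq.symm ((Int.modEq_iff_dvd).mpr ?_)
    rw [add_sub_cancel_left]
    exact (Int.natAbs_dvd.mpr (dvd_mul_left d 4))
  rw [kroneckerSym_of_odd _ hd, kroneckerSym_of_odd _ hd, hJ, ← mul_assoc]
  congr 1
  split_ifs <;> first | rfl | omega

lemma kroneckerSym_neg_four {d : ℤ} (hd : Odd d) : kroneckerSym (-4) d = ZMod.χ₄ d := by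
  have hn := Int.natAbs_odd.mpr hd
  rw [kroneckerSym_of_odd _ hd, show (-4 : ℤ) = 4 * -1 by norm_num, jacobiSym_four_mul _ hn,
    jacobiSym.at_neg_one hn]
  rcases lt_or_ge d 0 with h | h
  · have hneg : ∀ x : ZMod 4, ZMod.χ₄ (-x) = -ZMod.χ₄ x := by decide
    have hd' : d = -(d.natAbs : ℤ) := by omega
    have hcast : (d : ZMod 4) = -(d.natAbs : ZMod 4) := by
      rw [hd', Int.cast_neg, Int.cast_natCast, Int.natAbs_neg, Int.natAbs_natCast]
    rw [if_pos (by omega), hcast, hneg]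
    ring
  · have hcast : (d : ZMod 4) = (d.natAbs : ZMod 4) := by
      rw [← Int.cast_natCast, show (d.natAbs : ℤ) = d by omega]
    rw [if_neg (by omega), hcast, one_mul]

lemma kroneckerSym_neg_four_eq_or {d : ℤ} (hd : Odd d) :
    kroneckerSym (-4) d = 1 ∨ kroneckerSym (-4) d = -1 := by
  rw [kroneckerSym_neg_four hd, ZMod.χ₄_int_eq_if_mod_four,
    if_neg (by rcases hd with ⟨k, rfl⟩; omega)]
  split_ifs <;> simp

lemma kroneckerSym_neg_four_add {c d : ℤ} (hc : 4 ∣ c) (hd : Odd d) :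
    kroneckerSym (-4) (c + d) = kroneckerSym (-4) d := by
  obtain ⟨a, rfl⟩ := hc
  have h4 : (4 : ZMod 4) = 0 := rfl
  rw [kroneckerSym_neg_four hd, kroneckerSym_neg_four (Even.add_odd ⟨2 * a, by ring⟩ hd)]
  push_cast
  rw [h4, zero_mul, zero_add]

/-! ### The principal square root -/

/-- The defect of multiplicativity of the principal square root, for a factor `y` in the upper half
plane: there is a sign exactly when `x` lies in the closed upper and `x * y` in the open lower half
plane. -/
lemma cpow_half_mul_cpow_half {x y : ℂ} (hx : x ≠ 0) (hy : 0 < y.im) :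
    x ^ (1 / 2 : ℂ) * y ^ (1 / 2 : ℂ) =
      (if 0 ≤ x.im ∧ (x * y).im < 0 then -1 else 1) * (x * y) ^ (1 / 2 : ℂ) := by
  have hy0 : y ≠ 0 := by rintro rfl; simp at hy
  have hpi := Real.pi_pos
  have ay0 : 0 < y.arg := lt_of_le_of_ne (Complex.arg_nonneg_iff.mpr hy.le)
    fun h ↦ hy.ne' (Complex.arg_eq_zero_iff.mp h.symm).2
  have ay1 : y.arg < Real.pi := Complex.arg_lt_pi_iff.mpr (.inr hy.ne')
  have ax0 := Complex.neg_pi_lt_arg x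
  have ax1 := Complex.arg_le_pi x
  rw [Complex.cpow_def_of_ne_zero hx, Complex.cpow_def_of_ne_zero hy0,
    Complex.cpow_def_of_ne_zero (mul_ne_zero hx hy0), ← Complex.exp_add]
  rcases le_or_gt (x.arg + y.arg) Real.pi with h | h
  · have hmem : x.arg + y.arg ∈ Set.Ioc (-Real.pi) Real.pi := ⟨by linarith, h⟩
    have hcond : ¬ (0 ≤ x.im ∧ (x * y).im < 0) := by
      rintro ⟨h1, h2⟩
      rw [← Complex.arg_nonneg_iff] at h1
      rw [← Complex.arg_neg_iff, (Complex.arg_mul_eq_add_arg_iff hx hy0).mpr hmem] at h2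
      linarith
    rw [if_neg hcond, Complex.log_mul hx hy0 hmem, one_mul]
    ring_nf
  · have hlog : Complex.log (x * y) =
        Complex.log x + Complex.log y - 2 * Real.pi * Complex.I := by
      have e : x * y =
          Complex.exp (Complex.log x + Complex.log y - 2 * Real.pi * Complex.I) := by
        rw [Complex.exp_sub, Complex.exp_add, Complex.exp_log hx, Complex.exp_log hy0,
          Complex.exp_two_pi_mul_I, div_one]
      conv_lhs => rw [e]
      refine Complex.log_exp ?_ ?_ <;> simp [Complex.log_im] <;> linarith
    have harg : (x * y).arg = x.arg + y.arg - 2 * Real.pi := by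
      rw [← Complex.log_im, hlog]
      simp [Complex.log_im]
    have hcond : 0 ≤ x.im ∧ (x * y).im < 0 := by
      rw [← Complex.arg_nonneg_iff, ← Complex.arg_neg_iff, harg]
      constructor <;> linarith
    rw [if_pos hcond, hlog, ← Complex.exp_pi_mul_I, ← Complex.exp_add]
    ring_nf

/-! ### The multiplier system of the theta function -/

lemma jacobiTheta_neg_inv {τ : ℂ} (hτ : 0 < τ.im) :
    jacobiTheta (-1 / τ) = (-Complex.I * τ) ^ (1 / 2 : ℂ) * jacobiTheta τ := by
  have h := jacobiTheta_S_smul ⟨τ, hτ⟩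
  rw [UpperHalfPlane.modular_S_smul] at h
  rw [← h]
  congr 1
  change -1 / τ = (-τ)⁻¹
  rw [neg_div, one_div, inv_neg]

lemma neg_one_div_im_pos {τ : ℂ} (hτ : 0 < τ.im) : 0 < (-1 / τ).im := by
  have h0 : τ ≠ 0 := by rintro rfl; simp at hτ
  rw [neg_div, one_div, Complex.neg_im, Complex.inv_im, neg_div, neg_neg]
  exact div_pos hτ (Complex.normSq_pos.mpr h0)

lemma theta_add_int (z : ℂ) (n : ℤ) : theta (z + n) = theta z := by
  induction n using Int.induction_on with
  | zero => simp
  | succ n ih => rw [Int.cast_add, Int.cast_one, ← add_assoc, theta_add_one, ih]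
  | pred n ih => rw [← ih, Int.cast_sub, Int.cast_one, ← theta_add_one (z + _)]; ring_nf

/-- The transformation of `θ` under `(1, 0; 4, 1)`, from the inversion formula applied twice. -/
lemma theta_div_four_mul_add_one {z : ℂ} (hz : 0 < z.im) :
    theta (z / (4 * z + 1)) = (4 * z + 1) ^ (1 / 2 : ℂ) * theta z := by
  set τ := 2 * z with hτdef
  have hτ : 0 < τ.im := two_mul_im_pos hz
  have hτ0 : τ ≠ 0 := by intro h; simp [h] at hτ
  set σ := -1 / τ - 2 with hσdef
  have hσ : 0 < σ.im := by
    have := neg_one_div_im_pos hτ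
    simpa [hσdef] using this
  have hσ0 : σ ≠ 0 := by intro h; simp [h] at hσ
  have hστ : σ * τ = -(4 * z + 1) := by
    rw [hσdef]; field_simp; rw [hτdef]; ring
  have hw : 4 * z + 1 ≠ 0 := by
    intro h; rw [h, neg_zero] at hστ; exact mul_ne_zero hσ0 hτ0 hστ
  have harg {w : ℂ} (hw : 0 < w.im) : |(-Complex.I * w).arg| < Real.pi / 2 :=
    Complex.abs_arg_lt_pi_div_two_iff.mpr (.inl (by simpa using hw))
  have h1 := abs_lt.mp (harg hσ)
  have h2 := abs_lt.mp (harg hτ)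
  have n1 : -Complex.I * σ ≠ 0 := mul_ne_zero (neg_ne_zero.mpr Complex.I_ne_zero) hσ0
  have n2 : -Complex.I * τ ≠ 0 := mul_ne_zero (neg_ne_zero.mpr Complex.I_ne_zero) hτ0
  have e1 : 2 * (z / (4 * z + 1)) = -1 / σ := by
    rw [← mul_div_assoc, div_eq_div_iff hw hσ0]
    linear_combination hστ - σ * hτdef
  have e2 : 2 + σ = -1 / τ := by rw [hσdef]; ring
  have e3 : -Complex.I * σ * (-Complex.I * τ) = 4 * z + 1 := by
    linear_combination Complex.I ^ 2 * hστ - (4 * z + 1) * Complex.I_sq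
  rw [theta_eq_jacobiTheta, theta_eq_jacobiTheta, e1, jacobiTheta_neg_inv hσ,
    ← jacobiTheta_two_add σ, e2, jacobiTheta_neg_inv hτ, ← mul_assoc]
  congr 1
  rw [← e3, Complex.cpow_def_of_ne_zero n1, Complex.cpow_def_of_ne_zero n2,
    Complex.cpow_def_of_ne_zero (mul_ne_zero n1 n2), ← Complex.exp_add,
    Complex.log_mul n1 n2 ⟨by linarith, by linarith⟩]
  ring_nf

/-- The matrix `(1, 0; 4, 1)`, which together with `T` and `-1` generates `Γ₀(4)`. -/
def lowerFour : SL(2, ℤ) := ⟨!![1, 0; 4, 1], by simp⟩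

lemma coe_lowerFour : (lowerFour : Matrix (Fin 2) (Fin 2) ℤ) = !![1, 0; 4, 1] := rfl

lemma coe_smul_eq (γ : SL(2, ℤ)) (z : ℍ) :
    ((γ • z : ℍ) : ℂ) = ((γ 0 0 : ℂ) * z + γ 0 1) / ((γ 1 0 : ℂ) * z + γ 1 1) := by
  rw [UpperHalfPlane.coe_specialLinearGroup_apply]
  simp

lemma four_dvd_of_mem_Gamma0 {γ : SL(2, ℤ)} (hγ : γ ∈ Gamma0 4) : 4 ∣ γ 1 0 := by
  have h := (ZMod.intCast_zmod_eq_zero_iff_dvd (γ 1 0) 4).mp (Gamma0_mem.mp hγ)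
  exact_mod_cast h

lemma odd_of_mem_Gamma0 {γ : SL(2, ℤ)} (hγ : γ ∈ Gamma0 4) : Odd (γ 1 1) := by
  obtain ⟨c, hc⟩ := four_dvd_of_mem_Gamma0 hγ
  have hdet := Matrix.SpecialLinearGroup.det_coe γ
  rw [Matrix.det_fin_two, hc] at hdet
  by_contra h
  obtain ⟨k, hk⟩ := Int.not_odd_iff_even.mp h
  rw [hk] at hdet
  have : 2 * (γ 0 0 * k - 2 * (γ 0 1 * c)) = 1 := by linear_combination hdet
  omega

lemma T_mem_Gamma0 (N : ℕ) : ModularGroup.T ∈ Gamma0 N := by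
  rw [Gamma0_mem, ModularGroup.coe_T]
  simp

lemma lowerFour_mem_Gamma0 : lowerFour ∈ Gamma0 4 := by
  rw [Gamma0_mem]
  rfl

lemma coe_T_smul (z : ℍ) : ((ModularGroup.T • z : ℍ) : ℂ) = z + 1 := by
  rw [coe_smul_eq, ModularGroup.coe_T]
  simp

lemma mul_T_apply (γ : SL(2, ℤ)) :
    (γ * ModularGroup.T) 1 0 = γ 1 0 ∧ (γ * ModularGroup.T) 1 1 = γ 1 0 + γ 1 1 := by
  rw [Matrix.SpecialLinearGroup.coe_mul, ModularGroup.coe_T]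
  simp [Matrix.mul_apply, Fin.sum_univ_two]

lemma mul_lowerFour_apply (γ : SL(2, ℤ)) :
    (γ * lowerFour) 1 0 = γ 1 0 + 4 * γ 1 1 ∧ (γ * lowerFour) 1 1 = γ 1 1 := by
  rw [Matrix.SpecialLinearGroup.coe_mul, coe_lowerFour]
  simp [Matrix.mul_apply, Fin.sum_univ_two, mul_comm]

lemma autFactor_mul_T {γ : SL(2, ℤ)} (hγ : γ ∈ Gamma0 4) (z : ℍ) :
    autFactor 1 (γ * ModularGroup.T) z * theta z =
      autFactor 1 γ (ModularGroup.T • z) * theta (ModularGroup.T • z : ℍ) := by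
  have hc := four_dvd_of_mem_Gamma0 hγ
  have hd := odd_of_mem_Gamma0 hγ
  rw [autFactor, autFactor, (mul_T_apply γ).1, (mul_T_apply γ).2, kroneckerSym_add_self hc hd,
    kroneckerSym_neg_four_add hc hd, coe_T_smul, theta_add_one]
  push_cast
  ring_nf

lemma autFactor_mul_lowerFour {γ : SL(2, ℤ)} (hγ : γ ∈ Gamma0 4) (z : ℍ) :
    autFactor 1 (γ * lowerFour) z * theta z =
      autFactor 1 γ (lowerFour • z) * theta (lowerFour • z : ℍ) := by
  have hd := odd_of_mem_Gamma0 hγ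
  have hw : 0 < (4 * (z : ℂ) + 1).im := by simpa using z.im_pos
  have hw0 : 4 * (z : ℂ) + 1 ≠ 0 := by intro h; simp [h] at hw
  have hV : ((lowerFour • z : ℍ) : ℂ) = z / (4 * z + 1) := by
    rw [coe_smul_eq, coe_lowerFour]
    simp
  set x : ℂ := (γ 1 0 : ℂ) * (lowerFour • z : ℍ) + γ 1 1 with hx
  have hx0 : x ≠ 0 := by
    rw [hx, ← ModularGroup.denom_apply]; exact denom_ne_zero γ _
  have hxim : 0 ≤ x.im ↔ 0 ≤ γ 1 0 := by
    have : x.im = γ 1 0 * (lowerFour • z : ℍ).im := by simp [hx]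
    rw [this, mul_nonneg_iff_of_pos_right (lowerFour • z : ℍ).im_pos, Int.cast_nonneg_iff]
  have hxy : x * (4 * z + 1) = ((γ 1 0 + 4 * γ 1 1 : ℤ) : ℂ) * z + γ 1 1 := by
    rw [hx, hV]
    push_cast
    linear_combination (γ 1 0 : ℂ) * div_mul_cancel₀ (z : ℂ) hw0
  have hxyim : (x * (4 * z + 1)).im < 0 ↔ γ 1 0 + 4 * γ 1 1 < 0 := by
    have : (x * (4 * z + 1)).im = (γ 1 0 + 4 * γ 1 1 : ℤ) * z.im := by
      rw [hxy]; simp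
    rw [this, ← not_le, mul_nonneg_iff_of_pos_right z.im_pos, Int.cast_nonneg_iff, not_le]
  have hs := cpow_half_mul_cpow_half hx0 hw
  simp only [hxim, hxyim] at hs
  rw [autFactor, autFactor, (mul_lowerFour_apply γ).1, (mul_lowerFour_apply γ).2,
    kroneckerSym_add_four_mul _ hd, ← hxy, ← hx, hV, theta_div_four_mul_add_one z.im_pos]
  simp only [Int.cast_one, Int.cast_mul, Int.cast_ite, Int.cast_neg]
  linear_combination -((kroneckerSym (γ 1 0) (γ 1 1) : ℂ) *
    (kroneckerSym (-4) (γ 1 1) : ℂ) ^ (-(1 : ℂ) / 2) * theta z) * hs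

/-- `θ` transforms under `γ` like a modular form of weight `1 / 2`. -/
def ThetaLaw (γ : SL(2, ℤ)) : Prop := ∀ z : ℍ, theta (γ • z : ℍ) = autFactor 1 γ z * theta z

lemma thetaLaw_mul_iff {γ δ : SL(2, ℤ)}
    (h : ∀ z : ℍ, autFactor 1 (γ * δ) z * theta z = autFactor 1 γ (δ • z) * theta (δ • z : ℍ)) :
    ThetaLaw (γ * δ) ↔ ThetaLaw γ := by
  refine ⟨fun H z ↦ ?_, fun H z ↦ ?_⟩
  · have := H (δ⁻¹ • z)
    rwa [h, smul_smul, smul_smul, mul_assoc, mul_inv_cancel, mul_one, one_smul] at this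
  · rw [h, mul_smul, H]

lemma thetaLaw_of_lower_left_eq_zero {γ : SL(2, ℤ)} (hc : γ 1 0 = 0) : ThetaLaw γ := by
  intro z
  have hdet := Matrix.SpecialLinearGroup.det_coe γ
  rw [Matrix.det_fin_two, hc, mul_zero, sub_zero] at hdet
  rw [autFactor, coe_smul_eq, hc]
  rcases Int.eq_one_or_neg_one_of_mul_eq_one' hdet with ⟨ha, hd⟩ | ⟨ha, hd⟩
  · have h1 : kroneckerSym 0 1 = 1 := by simp [kroneckerSym_of_odd]
    have h2 : kroneckerSym (-4) 1 = 1 := by simp [kroneckerSym_of_odd]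
    rw [ha, hd, h1, h2]
    simp [theta_add_int]
  · have h1 : kroneckerSym 0 (-1) = 1 := by simp [kroneckerSym_of_odd]
    have h2 : kroneckerSym (-4) (-1) = -1 := by simp [kroneckerSym_of_odd]
    have h3 : (-1 : ℂ) ^ (-(1 : ℂ) / 2) * (-1 : ℂ) ^ ((1 : ℂ) / 2) = 1 := by
      rw [← Complex.cpow_add _ _ (by norm_num)]
      norm_num
    have h4 : ((-1 : ℂ) * z + γ 0 1) / -1 = z + ((-γ 0 1 : ℤ) : ℂ) := by
      push_cast
      ring
    rw [ha, hd, h1, h2]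
    push_cast
    rw [zero_mul, zero_add, h4, theta_add_int, one_mul, h3, one_mul]

/-- The theta multiplier system. The lower row `(c, d)` of an element of `Γ₀(4)` is reduced to
`(0, ±1)` by a Euclidean algorithm consisting of right multiplications by powers of `T` and
`lowerFour`. It does not stop earlier because `|c| = 2 |d|` is impossible for odd `d` and
`4 ∣ c`. -/
theorem theta_smul {γ : SL(2, ℤ)} (hγ : γ ∈ Gamma0 4) : ThetaLaw γ := by
  induction hn : (γ 1 0).natAbs + (γ 1 1).natAbs using Nat.strong_induction_on generalizing γ with
  | _ n ih =>
  rcases eq_or_ne (γ 1 0) 0 with hc | hc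
  · exact thetaLaw_of_lower_left_eq_zero hc
  obtain ⟨k, hk⟩ := odd_of_mem_Gamma0 hγ
  obtain ⟨l, hl⟩ := four_dvd_of_mem_Gamma0 hγ
  have hT := T_mem_Gamma0 4
  have hV := lowerFour_mem_Gamma0
  have stepT : (γ 1 0 + γ 1 1).natAbs < (γ 1 1).natAbs → ThetaLaw γ := fun h ↦
    (thetaLaw_mul_iff (autFactor_mul_T hγ)).mp <| ih _ (by
      rw [← hn, (mul_T_apply γ).1, (mul_T_apply γ).2]; omega) (mul_mem hγ hT) rfl
  have stepV : (γ 1 0 + 4 * γ 1 1).natAbs < (γ 1 0).natAbs → ThetaLaw γ := fun h ↦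
    (thetaLaw_mul_iff (autFactor_mul_lowerFour hγ)).mp <| ih _ (by
      rw [← hn, (mul_lowerFour_apply γ).1, (mul_lowerFour_apply γ).2]; omega) (mul_mem hγ hV) rfl
  have stepT' : (γ 1 1 - γ 1 0).natAbs < (γ 1 1).natAbs → ThetaLaw γ := fun h ↦ by
    have hmem := mul_mem hγ (inv_mem hT)
    have e := mul_T_apply (γ * ModularGroup.T⁻¹)
    have key := thetaLaw_mul_iff (autFactor_mul_T hmem)
    rw [inv_mul_cancel_right] at e key
    exact key.mpr (ih _ (by rw [← hn]; omega) hmem rfl)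
  have stepV' : (γ 1 0 - 4 * γ 1 1).natAbs < (γ 1 0).natAbs → ThetaLaw γ := fun h ↦ by
    have hmem := mul_mem hγ (inv_mem hV)
    have e := mul_lowerFour_apply (γ * lowerFour⁻¹)
    have key := thetaLaw_mul_iff (autFactor_mul_lowerFour hmem)
    rw [inv_mul_cancel_right] at e key
    exact key.mpr (ih _ (by rw [← hn]; omega) hmem rfl)
  by_cases h1 : (γ 1 0 + γ 1 1).natAbs < (γ 1 1).natAbs
  · exact stepT h1
  by_cases h2 : (γ 1 0 + 4 * γ 1 1).natAbs < (γ 1 0).natAbs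
  · exact stepV h2
  by_cases h3 : (γ 1 1 - γ 1 0).natAbs < (γ 1 1).natAbs
  · exact stepT' h3
  exact stepV' (by omega)

end

/-! ### Growth towards the real line -/

section

open Filter Topology UpperHalfPlane CongruenceSubgroup
open scoped MatrixGroups Manifold

lemma norm_exp_two_pi_I_mul (z : ℂ) :
    ‖Complex.exp (2 * Real.pi * Complex.I * z)‖ = Real.exp (-2 * Real.pi * z.im) := by
  rw [Complex.norm_exp]
  congr 1
  simp

lemma exp_two_pi_I_mul_I_mul (y : ℝ) : Complex.exp (2 * Real.pi * Complex.I * (Complex.I * y)) =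
    (Real.exp (-2 * Real.pi * y) : ℝ) := by
  rw [Complex.ofReal_exp]
  congr 1
  push_cast
  linear_combination 2 * Real.pi * y * Complex.I_sq

lemma norm_ofReal_exp_lt_one {y : ℝ} (hy : 0 < y) :
    ‖((Real.exp (-2 * Real.pi * y) : ℝ) : ℂ)‖ < 1 := by
  rw [Complex.norm_of_nonneg (Real.exp_nonneg _), Real.exp_lt_one_iff]
  nlinarith [Real.pi_pos]

lemma exp_neg_two_pi_mul_le {y y' : ℝ} (h : y ≤ y') :
    Real.exp (-2 * Real.pi * y') ≤ Real.exp (-2 * Real.pi * y) :=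
  Real.exp_le_exp.mpr (mul_le_mul_of_nonpos_left h (by linarith [Real.pi_pos]))

/-- The values `θ(i y)` on the imaginary axis, as real numbers. -/
def thetaSum (y : ℝ) : ℝ := ∑' n : ℤ, Real.exp (-2 * Real.pi * y) ^ (n ^ 2)

lemma summable_thetaSum {y : ℝ} (hy : 0 < y) :
    Summable fun n : ℤ ↦ Real.exp (-2 * Real.pi * y) ^ (n ^ 2) := by
  refine (summable_norm_pow_sq (norm_ofReal_exp_lt_one hy)).congr fun n ↦ ?_
  rw [norm_zpow, Complex.norm_of_nonneg (Real.exp_nonneg _)]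

lemma norm_theta_le_thetaSum (z : ℍ) : ‖theta z‖ ≤ thetaSum z.im := by
  have h (n : ℤ) : ‖Complex.exp (2 * Real.pi * Complex.I * z) ^ (n ^ 2)‖ =
      Real.exp (-2 * Real.pi * z.im) ^ (n ^ 2) := by
    rw [norm_zpow, norm_exp_two_pi_I_mul]
    rfl
  refine (norm_tsum_le_tsum_norm ?_).trans_eq (tsum_congr h)
  exact (summable_thetaSum z.im_pos).congr fun n ↦ (h n).symm

lemma theta_I_mul (y : ℝ) : theta (Complex.I * y) = thetaSum y := by
  rw [theta, exp_two_pi_I_mul_I_mul, thetaSum, Complex.ofReal_tsum]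
  push_cast
  rfl

lemma thetaSum_antitone {y y' : ℝ} (hy : 0 < y) (h : y ≤ y') : thetaSum y' ≤ thetaSum y :=
  (summable_thetaSum (hy.trans_le h)).tsum_le_tsum
    (fun n ↦ zpow_le_zpow_left₀ (sq_nonneg n) (Real.exp_nonneg _) (exp_neg_two_pi_mul_le h))
    (summable_thetaSum hy)

lemma thetaSum_nonneg (y : ℝ) : 0 ≤ thetaSum y := tsum_nonneg fun _ ↦ by positivity

lemma thetaSum_inv {y : ℝ} (hy : 0 < y) :
    thetaSum (1 / (4 * y)) = (2 * y) ^ (1 / 2 : ℝ) * thetaSum y := by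
  have him : 0 < (2 * (Complex.I * y)).im := by simpa using hy
  have hy0 : (y : ℂ) ≠ 0 := Complex.ofReal_ne_zero.mpr hy.ne'
  have h := jacobiTheta_neg_inv him
  have e1 : -1 / (2 * (Complex.I * y)) = 2 * (Complex.I * ((1 / (4 * y) : ℝ) : ℂ)) := by
    push_cast
    rw [div_eq_iff (mul_ne_zero two_ne_zero (mul_ne_zero Complex.I_ne_zero hy0))]
    field_simp
    linear_combination -4 * Complex.I_sq
  have e2 : -Complex.I * (2 * (Complex.I * y)) = ((2 * y : ℝ) : ℂ) := by
    push_cast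
    linear_combination -2 * (y : ℂ) * Complex.I_sq
  rw [e1, ← theta_eq_jacobiTheta, ← theta_eq_jacobiTheta, theta_I_mul, theta_I_mul, e2] at h
  have e3 : ((2 * y : ℝ) : ℂ) ^ (1 / 2 : ℂ) = ((2 * y) ^ (1 / 2 : ℝ) : ℝ) := by
    rw [Complex.ofReal_cpow (by positivity)]
    norm_num
  rw [e3] at h
  exact_mod_cast h

/-- The growth scale `max(1, 1 / y)` of modular forms towards the real line. -/
def growth (y : ℝ) : ℝ := max 1 y⁻¹

lemma one_le_growth (y : ℝ) : 1 ≤ growth y := le_max_left _ _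

lemma growth_antitone {y y' : ℝ} (hy : 0 < y) (h : y ≤ y') : growth y' ≤ growth y :=
  max_le_max le_rfl (inv_anti₀ hy h)

lemma norm_theta_le (z : ℍ) : ‖theta z‖ ≤ thetaSum (1 / 4) * growth z.im ^ (1 / 2 : ℝ) := by
  have hy := z.im_pos
  refine (norm_theta_le_thetaSum z).trans ?_
  have hC := thetaSum_nonneg (1 / 4)
  rcases le_or_gt 1 z.im with h | h
  · calc thetaSum z.im ≤ thetaSum (1 / 4) := thetaSum_antitone (by norm_num) (by linarith)
      _ ≤ thetaSum (1 / 4) * growth z.im ^ (1 / 2 : ℝ) :=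
        le_mul_of_one_le_right hC (Real.one_le_rpow (one_le_growth _) (by norm_num))
  · have h1 : thetaSum (1 / (4 * z.im)) ≤ thetaSum (1 / 4) :=
      thetaSum_antitone (by norm_num)
        (one_div_le_one_div_of_le (by positivity) (by linarith))
    rw [thetaSum_inv hy] at h1
    have h2 : z.im ^ (1 / 2 : ℝ) * thetaSum z.im ≤ thetaSum (1 / 4) := by
      refine le_trans ?_ h1
      gcongr
      · exact thetaSum_nonneg _
      · linarith
    have h3 : z.im⁻¹ ^ (1 / 2 : ℝ) ≤ growth z.im ^ (1 / 2 : ℝ) :=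
      Real.rpow_le_rpow (by positivity) (le_max_right _ _) (by norm_num)
    refine le_trans ?_ (mul_le_mul_of_nonneg_left h3 hC)
    rw [Real.inv_rpow hy.le, ← div_eq_mul_inv, le_div_iff₀ (by positivity)]
    linarith

/-- The values `G₂(i y) + 1 / 24` on the imaginary axis, as real numbers. -/
def sigmaSum (y : ℝ) : ℝ :=
  ∑' n : ℕ+, (ArithmeticFunction.sigma 1 (n : ℕ) : ℝ) * Real.exp (-2 * Real.pi * y) ^ (n : ℕ)

lemma summable_sigmaSum {y : ℝ} (hy : 0 < y) : Summable fun n : ℕ+ ↦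
    (ArithmeticFunction.sigma 1 (n : ℕ) : ℝ) * Real.exp (-2 * Real.pi * y) ^ (n : ℕ) := by
  have h := EisensteinSeries.summable_sigma_mul_cexp_pow (k := 2) one_le_two
    ⟨Complex.I * y, by simpa using hy⟩
  refine (h.norm.comp_injective PNat.coe_injective).congr fun n ↦ ?_
  simp only [Function.comp_apply, norm_mul, norm_pow, Complex.norm_natCast]
  rw [norm_exp_two_pi_I_mul]
  simp

lemma norm_eisG2_le_sigmaSum (z : ℍ) : ‖eisG2 z‖ ≤ 1 / 24 + sigmaSum z.im := by
  have h (n : ℕ+) : ‖(ArithmeticFunction.sigma 1 (n : ℕ) : ℂ) *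
      Complex.exp (2 * Real.pi * Complex.I * z) ^ (n : ℕ)‖ =
      (ArithmeticFunction.sigma 1 (n : ℕ) : ℝ) * Real.exp (-2 * Real.pi * z.im) ^ (n : ℕ) := by
    rw [norm_mul, norm_pow, norm_exp_two_pi_I_mul, Complex.norm_natCast]
    rfl
  refine (norm_add_le _ _).trans (add_le_add (by norm_num) ?_)
  refine (norm_tsum_le_tsum_norm ?_).trans_eq (tsum_congr h)
  exact (summable_sigmaSum z.im_pos).congr fun n ↦ (h n).symm

lemma eisG2_I_mul (y : ℝ) : eisG2 (Complex.I * y) = -1 / 24 + sigmaSum y := by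
  rw [eisG2, exp_two_pi_I_mul_I_mul, sigmaSum, Complex.ofReal_tsum]
  push_cast
  rfl

lemma sigmaSum_antitone {y y' : ℝ} (hy : 0 < y) (h : y ≤ y') : sigmaSum y' ≤ sigmaSum y :=
  (summable_sigmaSum (hy.trans_le h)).tsum_le_tsum
    (fun n ↦ by
      have := exp_neg_two_pi_mul_le h
      gcongr)
    (summable_sigmaSum hy)

lemma sigmaSum_nonneg (y : ℝ) : 0 ≤ sigmaSum y := tsum_nonneg fun _ ↦ by positivity

/-- The inversion formula for `G₂` on the imaginary axis. -/
lemma sigmaSum_inv {y : ℝ} (hy : 0 < y) :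
    sigmaSum (1 / y) = 1 / 24 + y ^ 2 * (1 / 24 - sigmaSum y) - y / (4 * Real.pi) := by
  have h := eisG2_smul ModularGroup.S ⟨Complex.I * y, by simpa using hy⟩
  have hy0 : (y : ℂ) ≠ 0 := Complex.ofReal_ne_zero.mpr hy.ne'
  have hpi : (Real.pi : ℂ) ≠ 0 := Complex.ofReal_ne_zero.mpr Real.pi_ne_zero
  have e : ((ModularGroup.S • (⟨Complex.I * y, by simpa using hy⟩ : ℍ) : ℍ) : ℂ) =
      Complex.I * ((1 / y : ℝ) : ℂ) := by
    rw [coe_smul_eq, ModularGroup.coe_S]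
    simp
    field_simp
    linear_combination -Complex.I_sq
  rw [e, eisG2_I_mul, ModularGroup.coe_S] at h
  simp only [eisG2_I_mul] at h
  simp at h
  have h' : (sigmaSum (1 / y) : ℂ) =
      ((1 / 24 + y ^ 2 * (1 / 24 - sigmaSum y) - y / (4 * Real.pi) : ℝ) : ℂ) := by
    push_cast
    have hI : Complex.I * y / (4 * Real.pi * Complex.I) = (y : ℂ) / (4 * Real.pi) := by
      field_simp
    rw [one_div]
    rw [hI] at h
    linear_combination h + y ^ 2 * (-1 / 24 + sigmaSum y) * Complex.I_sq
  exact_mod_cast h'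

lemma norm_eisG2_le (z : ℍ) : ‖eisG2 z‖ ≤ (1 + sigmaSum 1) * growth z.im ^ 2 := by
  have hy := z.im_pos
  refine (norm_eisG2_le_sigmaSum z).trans ?_
  have hC := sigmaSum_nonneg 1
  have hg : 1 ≤ growth z.im ^ 2 := one_le_pow₀ (one_le_growth _)
  rcases le_or_gt 1 z.im with h | h
  · have := sigmaSum_antitone one_pos h
    nlinarith
  · have h1 : (z.im ^ 2)⁻¹ ≤ growth z.im ^ 2 := by
      rw [← inv_pow]
      exact pow_le_pow_left₀ (by positivity) (le_max_right _ _) 2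
    refine le_trans ?_ (mul_le_mul_of_nonneg_left h1 (by linarith))
    rw [← div_eq_mul_inv, le_div_iff₀ (by positivity)]
    have h2 := sigmaSum_inv hy
    have h3 : 0 ≤ sigmaSum (1 / z.im) := sigmaSum_nonneg _
    have h4 : 0 ≤ z.im / (4 * Real.pi) := by positivity
    have h5 : z.im ^ 2 ≤ 1 := pow_le_one₀ hy.le h.le
    nlinarith

lemma norm_eisG2_natMul_le (k : ℕ) [NeZero k] (z : ℍ) :
    ‖eisG2 (k * z)‖ ≤ (1 + sigmaSum 1) * growth z.im ^ 2 := by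
  refine (norm_eisG2_le (natMul k z)).trans ?_
  have hk : (1 : ℝ) ≤ k := Nat.one_le_cast.mpr (NeZero.one_le)
  have him : (natMul k z).im = k * z.im := by
    rw [← coe_im, coe_natMul]
    simp
  have h := growth_antitone z.im_pos (le_mul_of_one_le_left z.im_pos.le hk)
  have h0 : 0 ≤ growth (k * z.im) := zero_le_one.trans (one_le_growth _)
  have hC := sigmaSum_nonneg 1
  rw [him]
  gcongr

/-- The growth of `f m` towards the real line, with the exponent given by the weight. -/
lemma exists_norm_f_le (m : ℕ) [NeZero m] :
    ∃ C, 0 ≤ C ∧ ∀ z : ℍ, ‖f m z‖ ≤ C * growth z.im ^ (5 / 2 : ℝ) := by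
  set K := 1 + sigmaSum 1 with hK
  have hK0 : 0 ≤ K := by linarith [sigmaSum_nonneg 1]
  set c := ‖(2 / m : ℂ)‖ with hc
  refine ⟨thetaSum (1 / 4) * (K + c * (K + 5 * K + 4 * K)), ?_, fun z ↦ ?_⟩
  · have := thetaSum_nonneg (1 / 4)
    positivity
  have hg : 0 < growth z.im := zero_lt_one.trans_le (one_le_growth _)
  have h2 := norm_eisG2_natMul_le 2 z
  have h4 := norm_eisG2_natMul_le 4 z
  push_cast at h2 h4
  have hcof : ‖cofactor m z‖ ≤ (K + c * (K + 5 * K + 4 * K)) * growth z.im ^ 2 := by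
    have n5 : ‖(5 : ℂ) * eisG2 (2 * z)‖ ≤ 5 * (K * growth z.im ^ 2) := by
      rw [norm_mul, Complex.norm_ofNat]; gcongr
    have n4 : ‖(4 : ℂ) * eisG2 (4 * z)‖ ≤ 4 * (K * growth z.im ^ 2) := by
      rw [norm_mul, Complex.norm_ofNat]; gcongr
    calc ‖cofactor m z‖ ≤ ‖eisG2 (m * z)‖ +
          c * (‖eisG2 z‖ + ‖(5 : ℂ) * eisG2 (2 * z)‖ + ‖(4 : ℂ) * eisG2 (4 * z)‖) := by
          refine (norm_add_le _ _).trans (add_le_add le_rfl ?_)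
          rw [norm_mul]
          gcongr
          exact (norm_add_le _ _).trans (add_le_add (norm_sub_le _ _) le_rfl)
      _ ≤ K * growth z.im ^ 2 + c * (K * growth z.im ^ 2 + 5 * (K * growth z.im ^ 2) +
          4 * (K * growth z.im ^ 2)) := by
          gcongr
          · exact norm_eisG2_natMul_le m z
          · exact norm_eisG2_le z
      _ = _ := by ring
  have hpow : growth z.im ^ (5 / 2 : ℝ) = growth z.im ^ (1 / 2 : ℝ) * growth z.im ^ 2 := by
    rw [← Real.rpow_add_natCast hg.ne']
    norm_num
  rw [f_eq, norm_mul, hpow]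
  calc ‖theta z‖ * ‖cofactor m z‖ ≤ (thetaSum (1 / 4) * growth z.im ^ (1 / 2 : ℝ)) *
        ((K + c * (K + 5 * K + 4 * K)) * growth z.im ^ 2) := by
        exact mul_le_mul (norm_theta_le z) hcof (norm_nonneg _)
          (mul_nonneg (thetaSum_nonneg _) (Real.rpow_nonneg hg.le _))
    _ = _ := by ring

/-! ### Modularity -/

lemma autFactor_five {γ : SL(2, ℤ)} (hγ : γ ∈ Gamma0 4) (z : ℍ) :
    autFactor 5 γ z = autFactor 1 γ z * ((γ 1 0 : ℂ) * z + γ 1 1) ^ 2 := by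
  have hd : (γ 1 0 : ℂ) * z + γ 1 1 ≠ 0 := by
    rw [← ModularGroup.denom_apply]; exact denom_ne_zero γ z
  have h1 : ((γ 1 0 : ℂ) * z + γ 1 1) ^ (((5 : ℤ) : ℂ) / 2) =
      ((γ 1 0 : ℂ) * z + γ 1 1) ^ (((1 : ℤ) : ℂ) / 2) * ((γ 1 0 : ℂ) * z + γ 1 1) ^ 2 := by
    rw [← Complex.cpow_natCast _ 2, ← Complex.cpow_add _ _ hd]
    norm_num
  have h2 : (kroneckerSym (-4) (γ 1 1) : ℂ) ^ (-((5 : ℤ) : ℂ) / 2) =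
      (kroneckerSym (-4) (γ 1 1) : ℂ) ^ (-((1 : ℤ) : ℂ) / 2) := by
    have hk := kroneckerSym_neg_four_eq_or (odd_of_mem_Gamma0 hγ)
    have hsq : (kroneckerSym (-4) (γ 1 1) : ℂ) ^ 2 = 1 := by
      rcases hk with h | h <;> simp [h]
    have h0 : (kroneckerSym (-4) (γ 1 1) : ℂ) ≠ 0 := by
      rcases hk with h | h <;> simp [h]
    have hadd : (-((1 : ℤ) : ℂ) / 2) = (-((5 : ℤ) : ℂ) / 2) + (2 : ℕ) := by
      push_cast
      norm_num
    rw [hadd, Complex.cpow_add _ _ h0, Complex.cpow_natCast, hsq, mul_one]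
  rw [autFactor, autFactor, h1, h2]
  ring

lemma f_smul {m : ℕ} (hm : m ∈ ({1, 2, 4} : Set ℕ)) {γ : SL(2, ℤ)} (hγ : γ ∈ Gamma0 4) (z : ℍ) :
    f m (γ • z) = autFactor 5 γ z * f m z := by
  rw [f_eq, f_eq, theta_smul hγ z, cofactor_smul hm hγ, autFactor_five hγ]
  ring

lemma norm_autFactor_five_le {γ : SL(2, ℤ)} (hγ : γ ∈ Gamma0 4) (z : ℍ) :
    ‖autFactor 5 γ z‖ ≤ ‖(γ 1 0 : ℂ) * z + γ 1 1‖ ^ (5 / 2 : ℝ) := by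
  have hd := odd_of_mem_Gamma0 hγ
  have h1 : ‖(kroneckerSym (γ 1 0) (γ 1 1) : ℂ)‖ ≤ 1 := by
    rw [kroneckerSym_of_odd _ hd]
    rcases jacobiSym.trichotomy (γ 1 0) (γ 1 1).natAbs with hJ | hJ | hJ <;> split_ifs <;>
      simp [hJ]
  have h2 : ‖(kroneckerSym (-4) (γ 1 1) : ℂ) ^ (-((5 : ℤ) : ℂ) / 2)‖ = 1 := by
    have e : (-((5 : ℤ) : ℂ) / 2) = ((-5 / 2 : ℝ) : ℂ) := by push_cast; ring
    rw [e, Complex.norm_cpow_real]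
    rcases kroneckerSym_neg_four_eq_or hd with h | h <;> simp [h]
  have e : (((5 : ℤ) : ℂ) / 2) = ((5 / 2 : ℝ) : ℂ) := by push_cast; ring
  rw [autFactor, norm_mul, norm_mul, h2, e, Complex.norm_cpow_real, mul_one]
  exact mul_le_of_le_one_left (by positivity) h1

/-! ### Behaviour at the cusps -/

lemma conj_T_zpow_apply (γ : SL(2, ℤ)) (n : ℤ) :
    (γ * ModularGroup.T ^ n * γ⁻¹) 1 0 = -n * γ 1 0 ^ 2 ∧
      (γ * ModularGroup.T ^ n * γ⁻¹) 1 1 = 1 + n * γ 0 0 * γ 1 0 := by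
  have hdet := Matrix.SpecialLinearGroup.det_coe γ
  rw [Matrix.det_fin_two] at hdet
  rw [Matrix.SpecialLinearGroup.coe_mul, Matrix.SpecialLinearGroup.coe_mul,
    ModularGroup.coe_T_zpow, Matrix.SpecialLinearGroup.coe_inv, Matrix.adjugate_fin_two]
  simp only [Matrix.mul_apply, Fin.sum_univ_two, Matrix.of_apply, Matrix.cons_val',
    Matrix.cons_val_zero, Matrix.cons_val_one, Matrix.cons_val_fin_one]
  exact ⟨by ring, by linear_combination hdet⟩

lemma conj_T_zpow_mem_Gamma0 (γ : SL(2, ℤ)) (n : ℤ) :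
    γ * ModularGroup.T ^ (4 * n) * γ⁻¹ ∈ Gamma0 4 := by
  have h4 : (4 : ZMod 4) = 0 := rfl
  rw [Gamma0_mem, (conj_T_zpow_apply γ _).1]
  simp [h4]

/-- The absolute value of `(c z + d) ^ (-5 / 2) f(γ z)` does not increase under `z ↦ z + 4 n`, and
hence is invariant; stated without denominators. -/
lemma norm_mul_f_smul_le {m : ℕ} (hm : m ∈ ({1, 2, 4} : Set ℕ)) (γ : SL(2, ℤ)) (n : ℤ) (z : ℍ) :
    ‖f m (γ • ModularGroup.T ^ (4 * n) • z)‖ *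
        ‖(γ 1 0 : ℂ) * (z : ℂ) + γ 1 1‖ ^ (5 / 2 : ℝ) ≤
      ‖(γ 1 0 : ℂ) * ((ModularGroup.T ^ (4 * n) • z : ℍ) : ℂ) + γ 1 1‖ ^ (5 / 2 : ℝ) *
        ‖f m (γ • z)‖ := by
  set δ := γ * ModularGroup.T ^ (4 * n) * γ⁻¹ with hδ
  have hmem : δ ∈ Gamma0 4 := conj_T_zpow_mem_Gamma0 γ n
  have e : γ • ModularGroup.T ^ (4 * n) • z = δ • γ • z := by
    rw [hδ, smul_smul, smul_smul, inv_mul_cancel_right]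
  have hden : ((δ 1 0 : ℂ) * ((γ • z : ℍ) : ℂ) + δ 1 1) * ((γ 1 0 : ℂ) * (z : ℂ) + γ 1 1) =
      (γ 1 0 : ℂ) * ((ModularGroup.T ^ (4 * n) • z : ℍ) : ℂ) + γ 1 1 := by
    have h0 : (γ 1 0 : ℂ) * (z : ℂ) + γ 1 1 ≠ 0 := by
      rw [← ModularGroup.denom_apply]; exact denom_ne_zero γ z
    have hdet : (γ 0 0 : ℂ) * γ 1 1 - γ 0 1 * γ 1 0 = 1 := by
      have := Matrix.SpecialLinearGroup.det_coe γ
      rw [Matrix.det_fin_two] at this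
      exact_mod_cast this
    obtain ⟨d0, d1⟩ := conj_T_zpow_apply γ (4 * n)
    rw [d0, d1, coe_smul_eq, ModularGroup.coe_T_zpow_smul_eq]
    push_cast
    field_simp
    linear_combination (4 * n * γ 1 0 : ℂ) * hdet
  rw [e, f_smul hm hmem, norm_mul, ← hden, norm_mul, Real.mul_rpow (norm_nonneg _) (norm_nonneg _)]
  have := norm_autFactor_five_le hmem (γ • z)
  calc _ ≤ ‖(δ 1 0 : ℂ) * ((γ • z : ℍ) : ℂ) + δ 1 1‖ ^ (5 / 2 : ℝ) * ‖f m (γ • z)‖ *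
        ‖(γ 1 0 : ℂ) * (z : ℂ) + γ 1 1‖ ^ (5 / 2 : ℝ) := by gcongr
    _ = _ := by ring

/-- Holomorphy at the cusps. By `norm_mul_f_smul_le` the real part of `z` may be reduced to
`[0, 4)`; there `|c z + d|` lies between `1` and a multiple of `Im z`, and the growth bound with
exponent equal to the weight suffices. -/
lemma isBoundedAtImInfty_f_smul {m : ℕ} (hm : m ∈ ({1, 2, 4} : Set ℕ)) (γ : SL(2, ℤ)) :
    IsBoundedAtImInfty fun z : ℍ ↦
      ((γ 1 0 : ℂ) * (z : ℂ) + (γ 1 1 : ℂ)) ^ (-((5 : ℤ) : ℂ) / 2) * f m (γ • z) := by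
  have : NeZero m := ⟨by rcases hm with rfl | rfl | rfl <;> norm_num⟩
  obtain ⟨C, hC0, hC⟩ := exists_norm_f_le m
  set B : ℝ := 5 * |(γ 1 0 : ℝ)| + |(γ 1 1 : ℝ)| with hB
  rw [isBoundedAtImInfty_iff]
  refine ⟨C * (max 1 B) ^ (5 / 2 : ℝ), 1, fun z hz ↦ ?_⟩
  have e : (-((5 : ℤ) : ℂ) / 2) = ((-(5 / 2) : ℝ) : ℂ) := by push_cast; ring
  have hden (w : ℍ) : 0 < ‖(γ 1 0 : ℂ) * (w : ℂ) + γ 1 1‖ := by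
    rw [norm_pos_iff, ← ModularGroup.denom_apply]; exact denom_ne_zero γ w
  rw [norm_mul, e, Complex.norm_cpow_real, Real.rpow_neg (norm_nonneg _), inv_mul_le_iff₀
    (Real.rpow_pos_of_pos (hden z) _)]
  -- the translate `w = z - 4 n` with real part in `[0, 4)`
  set n : ℤ := ⌊z.re / 4⌋ with hn
  set w : ℍ := ModularGroup.T ^ (4 * -n) • z with hw
  have hwre : w.re = z.re - 4 * n := by
    rw [hw, ModularGroup.re_T_zpow_smul]; push_cast; ring
  have hwim : w.im = z.im := by rw [hw, ModularGroup.im_T_zpow_smul]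
  have hwz : z = ModularGroup.T ^ (4 * n) • w := by
    rw [hw, smul_smul, ← zpow_add]; simp
  have hre : |w.re| ≤ 4 := by
    have h1 := Int.floor_le (z.re / 4)
    have h2 := Int.lt_floor_add_one (z.re / 4)
    rw [← hn] at h1 h2
    rw [hwre, abs_le]
    constructor <;> linarith
  have hmain : ‖f m (γ • w)‖ ≤
      ‖(γ 1 0 : ℂ) * (w : ℂ) + γ 1 1‖ ^ (5 / 2 : ℝ) * (C * (max 1 B) ^ (5 / 2 : ℝ)) := by
    set D := ‖(γ 1 0 : ℂ) * (w : ℂ) + γ 1 1‖ with hD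
    have hD0 : 0 < D := hden w
    have hy : 1 ≤ w.im := hwim ▸ hz
    have hy0 : 0 < w.im := w.im_pos
    have him : (γ • w).im = w.im / D ^ 2 := by
      rw [ModularGroup.im_smul_eq_div_normSq, hD, ← ModularGroup.denom_apply,
        Complex.normSq_eq_norm_sq]
    have hD1 : 1 ≤ D := by
      rcases eq_or_ne (γ 1 0) 0 with hc | hc
      · have hdet := Matrix.SpecialLinearGroup.det_coe γ
        rw [Matrix.det_fin_two, hc, mul_zero, sub_zero] at hdet
        have : (1 : ℝ) ≤ |(γ 1 1 : ℝ)| := by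
          exact_mod_cast Int.one_le_abs (right_ne_zero_of_mul_eq_one hdet)
        rw [hD, hc]
        simpa using this
      · have h1 : (1 : ℝ) ≤ |(γ 1 0 : ℝ)| := by exact_mod_cast Int.one_le_abs hc
        have h2 : |((γ 1 0 : ℂ) * (w : ℂ) + γ 1 1).im| ≤ D := Complex.abs_im_le_norm _
        have h3 : ((γ 1 0 : ℂ) * (w : ℂ) + γ 1 1).im = γ 1 0 * w.im := by simp
        rw [h3, abs_mul, abs_of_pos hy0] at h2
        nlinarith
    have hD2 : D ≤ B * w.im := by
      have h1 : ‖(w : ℂ)‖ ≤ 4 + w.im := by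
        refine (Complex.norm_le_abs_re_add_abs_im _).trans ?_
        rw [coe_re, coe_im, abs_of_pos hy0]
        linarith
      have h2 : D ≤ |(γ 1 0 : ℝ)| * ‖(w : ℂ)‖ + |(γ 1 1 : ℝ)| := by
        refine (norm_add_le _ _).trans (le_of_eq ?_)
        rw [norm_mul, Complex.norm_intCast, Complex.norm_intCast]
      have h3 := abs_nonneg (γ 1 0 : ℝ)
      have h4 := abs_nonneg (γ 1 1 : ℝ)
      have h5 : |(γ 1 0 : ℝ)| * ‖(w : ℂ)‖ ≤ |(γ 1 0 : ℝ)| * (5 * w.im) := by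
        gcongr
        linarith
      nlinarith
    have hgr : growth (γ • w).im ≤ D * max 1 B := by
      rw [growth, him, inv_div]
      refine max_le ?_ ?_
      · nlinarith [le_max_left 1 B]
      · rw [div_le_iff₀ hy0]
        calc D ^ 2 = D * D := by ring
          _ ≤ D * (max 1 B * w.im) := by
            gcongr
            exact hD2.trans (mul_le_mul_of_nonneg_right (le_max_right _ _) hy0.le)
          _ = _ := by ring
    calc ‖f m (γ • w)‖ ≤ C * growth (γ • w).im ^ (5 / 2 : ℝ) := hC _
      _ ≤ C * (D * max 1 B) ^ (5 / 2 : ℝ) := by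
        gcongr
        exact zero_le_one.trans (one_le_growth _)
      _ = _ := by
        rw [Real.mul_rpow hD0.le (zero_le_one.trans (le_max_left _ _))]
        ring
  have htr := norm_mul_f_smul_le hm γ n w
  rw [← hwz] at htr
  have hpos := Real.rpow_pos_of_pos (hden w) (5 / 2 : ℝ)
  refine le_of_mul_le_mul_right (htr.trans ?_) hpos
  calc _ ≤ ‖(γ 1 0 : ℂ) * (z : ℂ) + γ 1 1‖ ^ (5 / 2 : ℝ) *
        (‖(γ 1 0 : ℂ) * (w : ℂ) + γ 1 1‖ ^ (5 / 2 : ℝ) * (C * (max 1 B) ^ (5 / 2 : ℝ))) := by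
        gcongr
    _ = _ := by ring

lemma mdifferentiable_f (m : ℕ) [NeZero m] : MDiff (f m) := by
  rw [UpperHalfPlane.mdifferentiable_iff]
  have him {z : ℂ} (hz : 0 < z.im) (k : ℕ) [NeZero k] : 0 < ((k : ℂ) * z).im :=
    (natMul k ⟨z, hz⟩).im_pos
  have hG (k : ℕ) [NeZero k] {z : ℂ} (hz : 0 < z.im) :
      DifferentiableAt ℂ (fun z ↦ eisG2 (k * z)) z :=
    (differentiableAt_eisG2 (him hz k)).comp z (by fun_prop)
  refine DifferentiableOn.congr (f := fun z ↦ theta z * cofactor m z) (fun z hz ↦ ?_) fun z hz ↦ ?_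
  · refine (DifferentiableAt.mul (differentiableAt_theta hz) ?_).differentiableWithinAt
    exact (hG m hz).add ((((differentiableAt_eisG2 hz).sub ((hG 2 hz).const_mul 5)).add
      ((hG 4 hz).const_mul 4)).const_mul _)
  · rw [Function.comp_apply, ofComplex_apply_of_im_pos hz, f_eq]

theorem f_mem_modularForms {m : ℕ} (hm : m ∈ ({1, 2, 4} : Set ℕ)) : f m ∈ modularForms 5 4 := by
  have : NeZero m := ⟨by rcases hm with rfl | rfl | rfl <;> norm_num⟩
  exact ⟨mdifferentiable_f m, fun γ hγ z ↦ f_smul hm hγ z, isBoundedAtImInfty_f_smul hm⟩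

/-! ### Fourier expansions -/

lemma periodic_f (m : ℕ) : Function.Periodic (f m ∘ ofComplex) ((1 : ℝ) : ℂ) := by
  intro w
  rw [Complex.ofReal_one]
  rcases lt_or_ge 0 w.im with hw | hw
  · have hw' : 0 < (w + 1).im := by simpa using hw
    have h2 := eisG2_natMul_add_one 2 w
    have h4 := eisG2_natMul_add_one 4 w
    push_cast at h2 h4
    simp only [Function.comp_apply, ofComplex_apply_of_im_pos hw, ofComplex_apply_of_im_pos hw',
      f_eq, cofactor]
    rw [theta_add_one, eisG2_natMul_add_one, eisG2_add_one, h2, h4]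
  · have hw' : (w + 1).im ≤ 0 := by simpa using hw
    simp [ofComplex_apply_of_im_nonpos hw, ofComplex_apply_of_im_nonpos hw']

lemma isBoundedAtImInfty_f {m : ℕ} (hm : m ∈ ({1, 2, 4} : Set ℕ)) : IsBoundedAtImInfty (f m) := by
  simpa using isBoundedAtImInfty_f_smul hm 1

lemma hasSum_a {m : ℕ} (hm : m ∈ ({1, 2, 4} : Set ℕ)) (z : ℍ) :
    HasSum (fun n : ℕ ↦ a m n * Complex.exp (2 * Real.pi * Complex.I * (z : ℂ)) ^ n) (f m z) := by
  have : NeZero m := ⟨by rcases hm with rfl | rfl | rfl <;> norm_num⟩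
  simpa [a, Function.Periodic.qParam] using
    hasSum_qExpansion one_pos (periodic_f m) (mdifferentiable_f m) (isBoundedAtImInfty_f hm) z

lemma a_one_sub_a_two_add_a_four (n : ℕ) : a 1 n - 5 * a 2 n + 4 * a 4 n = 0 := by
  have han {m : ℕ} (hm : m ∈ ({1, 2, 4} : Set ℕ)) : AnalyticAt ℂ (cuspFunction 1 (f m)) 0 := by
    have : NeZero m := ⟨by rcases hm with rfl | rfl | rfl <;> norm_num⟩
    exact analyticAt_cuspFunction_zero one_pos (periodic_f m) (mdifferentiable_f m)
      (isBoundedAtImInfty_f hm)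
  have h1 := han (m := 1) (by simp)
  have h2 := han (m := 2) (by simp)
  have h4 := han (m := 4) (by simp)
  have h2' : AnalyticAt ℂ (cuspFunction 1 ((5 : ℂ) • f 2)) 0 := by
    rw [cuspFunction_smul h2.continuousAt]; exact h2.const_smul
  have h4' : AnalyticAt ℂ (cuspFunction 1 ((4 : ℂ) • f 4)) 0 := by
    rw [cuspFunction_smul h4.continuousAt]; exact h4.const_smul
  have h12 : AnalyticAt ℂ (cuspFunction 1 (f 1 - (5 : ℂ) • f 2)) 0 := by
    rw [cuspFunction_sub h1.continuousAt h2'.continuousAt]; exact h1.sub h2'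
  have h := congr_arg (fun F ↦ (qExpansion 1 F).coeff n) f_one_sub_f_two_add_f_four
  simpa [a, qExpansion_add h12 h4', qExpansion_sub h1 h2', qExpansion_smul h2, qExpansion_smul h4,
    qExpansion_zero] using h

end

end HalfIntegralWeight

end

theorem proposition2p4 :
    (∀ m ∈ ({1, 2, 4} : Set ℕ),
      HalfIntegralWeight.f m ∈ HalfIntegralWeight.modularForms 5 4) ∧
    HalfIntegralWeight.f 1 - (5 : ℂ) • HalfIntegralWeight.f 2
      + (4 : ℂ) • HalfIntegralWeight.f 4 = 0 ∧
    (∀ m ∈ ({1, 2, 4} : Set ℕ), ∀ z : UpperHalfPlane,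
      HasSum (fun n : ℕ ↦ HalfIntegralWeight.a m n
        * Complex.exp (2 * Real.pi * Complex.I * (z : ℂ)) ^ n) (HalfIntegralWeight.f m z)) ∧
    ∀ n : ℕ, HalfIntegralWeight.a 1 n - 5 * HalfIntegralWeight.a 2 n
      + 4 * HalfIntegralWeight.a 4 n = 0 :=
  ⟨fun _ hm ↦ HalfIntegralWeight.f_mem_modularForms hm,
    HalfIntegralWeight.f_one_sub_f_two_add_f_four,
    fun _ hm z ↦ HalfIntegralWeight.hasSum_a hm z,
    HalfIntegralWeight.a_one_sub_a_two_add_a_four⟩
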